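/- For $\beta>0$ and $\kappa>0$ consider $$F_{\beta,\kappa}(\varphi)=\frac18\int_0^1\Bigl(\varphi'(x)^2+\frac1{\beta^2}\sin^2\varphi(x)\Bigr)dx-\frac{\kappa}{2}\int_0^1\varphi'(x)\,dx,\qquad \varphi\in\mathcal J=\{\varphi\in H^1((0,1)):\varphi(0)=0\}.$$ (A) For all $\beta>0$ and $0<\kappa<\frac1{\pi\beta}$ the functional $F_{\beta,\kappa}$ has a unique minimizer $\varphi_\beta$ in $\mathcal J$. It is smooth on $[0,1]$, $0<\varphi_\beta(x)<\frac\pi2$ for all $x\in(0,1)$, and $$\varphi_\beta(x)<2\arctan\Bigl[\tan\Bigl(\frac{\varphi_\beta(1)}2\Bigr)e^{\frac{x-1}{\beta}}\Bigr]\qquad\text{for all }x\in[0,1).$$ (B) Let now $\beta\to0^+$, where $\kappa=\kappa(\beta)>0$ may depend on $\beta$, with $\kappa\beta<\frac1\pi$ for all small $\beta$. Then $\varphi_\beta\to0$ in $C^\infty(K)$ for every compact $K\subset[0,1)$. Moreover: (i) If $\tilde\kappa=\kappa\beta$ is independent of $\beta$, then $\varphi_\beta(1)\to\arcsin(2\tilde\kappa)$;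 for every integer $n\ge1$, $$F_{\beta,\kappa}(\varphi_\beta)=\frac{1-\sqrt{1-4\tilde\kappa^2}}{4\beta}-\frac{\tilde\kappa}{2\beta}\arcsin(2\tilde\kappa)+o(\beta^n);$$ and the functions $\psi_\beta(x)=\varphi_\beta(1-\beta x)$, defined on $[0,1/\beta]$, converge in $C^\infty_{\mathrm{loc}}([0,+\infty))$ to $\psi_0(x)=2\arctan\bigl[\tan\bigl(\tfrac{\arcsin(2\tilde\kappa)}2\bigr)e^{-x}\bigr]$. (ii) If $\kappa\beta\to0$, then $\varphi_\beta(1)=2\kappa\beta(1+o(1))$ and $F_{\beta,\kappa}(\varphi_\beta)=-\frac{\kappa^2\beta}2(1+o(1))$; and the functions $\Phi_\beta(x)=\frac{\varphi_\beta(1-\beta x)}{2\kappa\beta}$, defined on $[0,1/\beta]$, converge in $C^\infty_{\mathrm{loc}}([0,+\infty))$ to $e^{-x}$. Here $C^\infty(K)$ convergence means uniform convergence on $K$ of the derivatives of every order (one-sided at end points of the domain), and $C^\infty_{\mathrm{loc}}([0,+\infty))$ convergence means this for every compact $K\subset[0,+\infty)$. -/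

import Mathlib

open Set Filter Topology MeasureTheory Asymptotics
open scoped ContDiff

/-- `g` is a weak derivative of `u` on the interval `(0,1)`:
`∫ u η' = - ∫ g η` for every smooth `η` with compact support in `(0,1)`. -/
def IsWeakDeriv (u g : ℝ → ℝ) : Prop :=
  ∀ η : ℝ → ℝ, ContDiff ℝ ∞ η → HasCompactSupport η → tsupport η ⊆ Ioo (0 : ℝ) 1 →
    ∫ x in (0 : ℝ)..1, u x * deriv η x = - ∫ x in (0 : ℝ)..1, g x * η x

/-- `u` has a weak derivative in `L²(0,1)`. -/
def HasL2WeakDeriv (u : ℝ → ℝ) : Prop :=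
  ∃ g : ℝ → ℝ, MemLp g 2 (volume.restrict (Ioo (0 : ℝ) 1)) ∧ IsWeakDeriv u g

/-- The Sobolev space `H¹((0,1))`. -/
def MemH1 (u : ℝ → ℝ) : Prop :=
  MemLp u 2 (volume.restrict (Ioo (0 : ℝ) 1)) ∧ HasL2WeakDeriv u

open Classical in
/-- The weak derivative of `u` on `(0,1)` (unique up to a null set, see `IsWeakDeriv.ae_eq`),
for `u` having one in `L²(0,1)`. -/
noncomputable def weakDeriv (u : ℝ → ℝ) : ℝ → ℝ :=
  if h : HasL2WeakDeriv u then h.choose else 0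

/-- `𝒥 = {φ ∈ H¹((0,1)) : φ(0) = 0}`. An element of `H¹((0,1))` is represented by its
continuous representative on `[0,1]`, through which the condition `φ(0) = 0` is read; the values
of `φ` outside `[0,1]` are irrelevant. -/
def spaceJ : Set (ℝ → ℝ) :=
  {φ | MemH1 φ ∧ ContinuousOn φ (Icc 0 1) ∧ φ 0 = 0}

/-- The energy
`F_{β,κ}(φ) = (1/8) ∫₀¹ (φ'² + β⁻² sin² φ) - (κ/2) ∫₀¹ φ'`. -/
noncomputable def energyF (β κ : ℝ) (φ : ℝ → ℝ) : ℝ :=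
  1 / 8 * (∫ x in (0 : ℝ)..1, ((weakDeriv φ x) ^ 2 + 1 / β ^ 2 * Real.sin (φ x) ^ 2))
    - κ / 2 * ∫ x in (0 : ℝ)..1, weakDeriv φ x

/-- `φ` minimizes `F_{β,κ}` in `𝒥`. -/
def IsMinimizer (β κ : ℝ) (φ : ℝ → ℝ) : Prop :=
  φ ∈ spaceJ ∧ ∀ χ ∈ spaceJ, energyF β κ φ ≤ energyF β κ χ

/-- Convergence `u_β → v` in `C^∞(K)` as `β → 0⁺`, where `u_β` is a function on `D β` and `v` a
function on `D₀` (one-sided derivatives are used at boundary points): for small `β` the function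
`u_β` is smooth on `D β`, and the derivatives of every order converge uniformly on `K`. -/
def TendstoSmooth (D : ℝ → Set ℝ) (u : ℝ → ℝ → ℝ) (D₀ : Set ℝ) (v : ℝ → ℝ) (K : Set ℝ) : Prop :=
  (∀ᶠ β in 𝓝[>] (0 : ℝ), K ⊆ D β ∧ ContDiffOn ℝ ∞ (u β) (D β)) ∧
  ∀ k : ℕ, TendstoUniformlyOn (fun β => iteratedDerivWithin k (u β) (D β))
    (iteratedDerivWithin k v D₀) (𝓝[>] (0 : ℝ)) K

/-- Two weak derivatives in `L²(0,1)` of the same function agree almost everywhere. -/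
theorem IsWeakDeriv.ae_eq {u g₁ g₂ : ℝ → ℝ} (h₁ : IsWeakDeriv u g₁) (h₂ : IsWeakDeriv u g₂)
    (m₁ : MemLp g₁ 2 (volume.restrict (Ioo (0 : ℝ) 1)))
    (m₂ : MemLp g₂ 2 (volume.restrict (Ioo (0 : ℝ) 1))) :
    g₁ =ᵐ[volume.restrict (Ioo (0 : ℝ) 1)] g₂ := by
  have i₁ : IntegrableOn g₁ (Ioo (0 : ℝ) 1) := m₁.integrable (by norm_num)
  have i₂ : IntegrableOn g₂ (Ioo (0 : ℝ) 1) := m₂.integrable (by norm_num)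
  have key := isOpen_Ioo.ae_eq_zero_of_integral_contDiff_smul_eq_zero (μ := volume)
    (f := fun x => g₁ x - g₂ x) (U := Ioo (0 : ℝ) 1) ((i₁.sub i₂).locallyIntegrableOn) ?_
  · rw [EventuallyEq, ae_restrict_iff' measurableSet_Ioo]
    filter_upwards [key] with x hx hm
    exact sub_eq_zero.mp (hx hm)
  · intro η hη hc hs
    have e : ∀ g : ℝ → ℝ, ∫ x in (0 : ℝ)..1, g x * η x
        = ∫ x in Ioo (0 : ℝ) 1, g x * η x := fun g => by
      rw [intervalIntegral.integral_of_le zero_le_one, integral_Ioc_eq_integral_Ioo]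
    have E := (h₁ η hη hc hs).symm.trans (h₂ η hη hc hs)
    rw [e, e, neg_inj] at E
    obtain ⟨C, hC⟩ := hc.exists_bound_of_continuous hη.continuous
    have j : ∀ g : ℝ → ℝ, IntegrableOn g (Ioo (0 : ℝ) 1) →
        IntegrableOn (fun x => g x * η x) (Ioo (0 : ℝ) 1) := fun g hg =>
      hg.mul_bdd (c := C) hη.continuous.aestronglyMeasurable (Eventually.of_forall hC)
    have z : ∫ x in Ioo (0 : ℝ) 1, (g₁ x * η x - g₂ x * η x) = 0 := by
      rw [integral_sub (j _ i₁) (j _ i₂), E, sub_self]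
    rw [← setIntegral_eq_integral_of_forall_compl_eq_zero (s := Ioo (0 : ℝ) 1)]
    · refine Eq.trans ?_ z
      congr 1
      funext x
      simp only [smul_eq_mul]
      ring
    · intro x hx
      have : η x = 0 := image_eq_zero_of_notMem_tsupport fun h => hx (hs h)
      simp [this]

/-! The proof is a calibration argument. For `c > 0`, completing the square with `speed β c y = √(c
+ sin² y / β²)` and integrating the cross term by the chain rule writes the energy of any competitor
as `-c/8`, plus an eighth of `∫ (χ' - speed β c (χ))²`, plus a quarter of `action β c (χ 1) - 2κ χ
1` (`energyF_eq`). A solution of `φ' = speed β c (φ)` kills the square. If moreover `φ'(1) = 2κ`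
with `φ 1` in `(0, π/2)`, its end point is the strict minimum of the last term over `[0, ∞)`
(`action_sub_lt`): this uses `action β c π ≥ 2/β > 2κπ`, the meaning of `κ < 1/(πβ)`. Competitors
ending below `0` have positive energy. Equality forces the same first-order equation, so uniqueness
reduces to that for an ODE. The constant `c` is found by shooting on the travel time
(`exists_isProfile`), so no compactness of minimizing sequences is needed.

The barrier holds because `speed` exceeds `sin / β`, which makes `tan (φ/2) e^{-x/β}` increasing. It
also makes `c` exponentially small, and `action` then differs from `(1 - cos y)/β` by at most `√c y`
on `[0, π]`, which gives the energy expansion.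

All smooth convergence comes from one family: `φ(1 - βy)/λ` solves `u'' = sin(2λu)/(2λ)`, whose
force is Lipschitz uniformly in `λ` and continuous up to `λ = 0`, and whose higher derivatives are
continuous functions of `(u, u', λ)`. The choices `λ = 1`, `λ = 2κβ` and `λ = e^{-δ/β}` give the
fixed-`κβ` profile, the linear limit `e^{-x}`, and decay away from `1`. -/

/-! ### Weak derivatives and absolutely continuous representatives -/

theorem intervalIntegrable_of_memLp_two {g : ℝ → ℝ}
    (hg : MemLp g 2 (volume.restrict (Ioo (0 : ℝ) 1))) : IntervalIntegrable g volume 0 1 := by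
  rw [intervalIntegrable_iff_integrableOn_Ioo_of_le zero_le_one]
  exact hg.integrable (by norm_num)

theorem exists_Icc_subset_Ioo_of_isCompact {K : Set ℝ} (hK : IsCompact K) (hs : K ⊆ Ioo 0 1) :
    ∃ a b : ℝ, 0 < a ∧ b < 1 ∧ K ⊆ Icc a b := by
  rcases K.eq_empty_or_nonempty with rfl | hne
  · exact ⟨1 / 2, 1 / 2, by norm_num, by norm_num, by simp⟩
  · obtain ⟨x, hx, hx'⟩ := hK.exists_isLeast hne
    obtain ⟨y, hy, hy'⟩ := hK.exists_isGreatest hne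
    exact ⟨x, y, (hs hx).1, (hs hy).2, fun z hz => ⟨hx' hz, hy' hz⟩⟩

/-- The primitive of an integrable function has that function as weak derivative. -/
theorem isWeakDeriv_primitive {g : ℝ → ℝ} (hg : IntervalIntegrable g volume 0 1) :
    IsWeakDeriv (fun x => ∫ t in (0 : ℝ)..x, g t) g := by
  intro η hη hc hs
  have h0 : η 0 = 0 := image_eq_zero_of_notMem_tsupport fun h => by simpa using hs h
  have h1 : η 1 = 0 := image_eq_zero_of_notMem_tsupport fun h => by simpa using hs h
  have hP := hg.absolutelyContinuousOnInterval_intervalIntegral (c := 0) (by simp)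
  have hE : AbsolutelyContinuousOnInterval η 0 1 :=
    (hη.of_le (by simp)).contDiffOn.absolutelyContinuousOnInterval
  rw [hP.integral_mul_deriv_eq_deriv_mul hE, h0, h1]
  simp only [mul_zero, sub_zero, zero_sub, neg_inj]
  apply intervalIntegral.integral_congr_ae
  filter_upwards [hg.ae_hasDerivAt_integral] with x hx hx'
  rw [(hx (uIoc_subset_uIcc hx') 0 (by simp)).deriv]

/-- A test function of integral zero is the derivative of a test function. -/
theorem exists_test_primitive {ζ : ℝ → ℝ} (hζ : ContDiff ℝ ∞ ζ) (hc : HasCompactSupport ζ)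
    (hs : tsupport ζ ⊆ Ioo (0 : ℝ) 1) (hz : ∫ x in (0 : ℝ)..1, ζ x = 0) :
    ∃ η : ℝ → ℝ, ContDiff ℝ ∞ η ∧ HasCompactSupport η ∧ tsupport η ⊆ Ioo (0 : ℝ) 1 ∧
      deriv η = ζ := by
  obtain ⟨a, b, ha, hb, hK⟩ := exists_Icc_subset_Ioo_of_isCompact hc hs
  have hζ0 : ∀ x, x ∉ Icc a b → ζ x = 0 := fun x hx =>
    image_eq_zero_of_notMem_tsupport fun h => hx (hK h)
  have hi : ∀ x y, IntervalIntegrable ζ volume x y := fun x y =>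
    hζ.continuous.intervalIntegrable x y
  have hd : deriv (fun x => ∫ t in (0 : ℝ)..x, ζ t) = ζ := by
    funext x
    exact (hζ.continuous.integral_hasStrictDerivAt 0 x).hasDerivAt.deriv
  have hsub : tsupport (fun x => ∫ t in (0 : ℝ)..x, ζ t) ⊆ Icc a b := by
    refine closure_minimal (fun x hx => ?_) isClosed_Icc
    by_contra hxn
    apply hx
    rw [mem_Icc, not_and_or, not_le, not_le] at hxn
    rcases hxn with h | h
    · refine (intervalIntegral.integral_congr (g := fun _ => 0) fun t ht =>
        hζ0 t fun h' => ?_).trans (by simp)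
      rw [mem_uIcc] at ht
      have := h'.1
      rcases ht with ht | ht <;> linarith [ht.2]
    · have e := intervalIntegral.integral_add_adjacent_intervals (hi 0 1) (hi 1 x)
      simp only
      rw [← e, hz, zero_add]
      refine (intervalIntegral.integral_congr (g := fun _ => 0) fun t ht =>
        hζ0 t fun h' => ?_).trans (by simp)
      rw [mem_uIcc] at ht
      have := h'.2
      rcases ht with ht | ht <;> linarith [ht.1]
  refine ⟨_, ?_, HasCompactSupport.of_support_subset_isCompact isCompact_Icc
    ((subset_tsupport _).trans hsub),
    hsub.trans fun x hx => ⟨ha.trans_le hx.1, hx.2.trans_lt hb⟩, hd⟩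
  rw [contDiff_infty_iff_deriv, hd]
  exact ⟨fun x => (hζ.continuous.integral_hasStrictDerivAt 0 x).hasDerivAt.differentiableAt, hζ⟩

/-- Du Bois-Reymond lemma for continuous functions on `[0,1]`. -/
theorem eqOn_const_of_isWeakDeriv_zero {w : ℝ → ℝ} (hw : ContinuousOn w (Icc 0 1))
    (h : IsWeakDeriv w (fun _ => 0)) : ∀ x ∈ Icc (0 : ℝ) 1, w x = w 0 := by
  -- A bump `ρ` of integral one supported in `[1/4, 3/4]`. For any test function `ζ`, `ζ - (∫ ζ) ρ`
  -- has integral zero, hence is the derivative of a test function; this tests `w - m` against `ζ`.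
  let f : ContDiffBump (1 / 2 : ℝ) := ⟨1 / 8, 1 / 4, by norm_num, by norm_num⟩
  set ρ := f.normed volume with hρdef
  have hρs : tsupport ρ ⊆ Ioo (0 : ℝ) 1 := by
    rw [f.tsupport_normed_eq]
    intro x hx
    rw [Metric.mem_closedBall, Real.dist_eq, abs_le] at hx
    have : f.rOut = 1 / 4 := rfl
    rw [this] at hx
    constructor <;> linarith [hx.1, hx.2]
  have hρ : ContDiff ℝ ∞ ρ := f.contDiff_normed
  have hρc : HasCompactSupport ρ := f.hasCompactSupport_normed
  have key : ∀ ζ : ℝ → ℝ, tsupport ζ ⊆ Ioo (0 : ℝ) 1 → ∀ v : ℝ → ℝ,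
      ∫ x, ζ x * v x = ∫ x in (0 : ℝ)..1, ζ x * v x := by
    intro ζ hζ v
    rw [intervalIntegral.integral_of_le zero_le_one, integral_Ioc_eq_integral_Ioo]
    refine (setIntegral_eq_integral_of_forall_compl_eq_zero fun x hx => ?_).symm
    rw [image_eq_zero_of_notMem_tsupport fun h => hx (hζ h), zero_mul]
  have hρ1 : ∫ x in (0 : ℝ)..1, ρ x = 1 := by
    have := key ρ hρs (fun _ => 1)
    simp only [mul_one] at this
    rw [← this, f.integral_normed]
  set m := ∫ x in (0 : ℝ)..1, ρ x * w x with hm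
  have hwi : ∀ ζ : ℝ → ℝ, Continuous ζ →
      IntervalIntegrable (fun x => ζ x * w x) volume 0 1 := fun ζ hζ =>
    (hζ.continuousOn.mul (by rwa [uIcc_of_le zero_le_one])).intervalIntegrable
  have hae := isOpen_Ioo.ae_eq_zero_of_integral_contDiff_smul_eq_zero (μ := volume)
    (f := fun x => w x - m) (U := Ioo (0 : ℝ) 1)
    (((hw.sub continuousOn_const).mono Ioo_subset_Icc_self).locallyIntegrableOn
      measurableSet_Ioo) ?_
  · have hcst : EqOn w (fun _ => m) (Ioo 0 1) := by
      refine Measure.eqOn_open_of_ae_eq (μ := volume) ?_ isOpen_Ioo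
        (hw.mono Ioo_subset_Icc_self) continuousOn_const
      rw [EventuallyEq, ae_restrict_iff' measurableSet_Ioo]
      filter_upwards [hae] with x hx hx'
      exact sub_eq_zero.1 (hx hx')
    have hcst' : EqOn w (fun _ => m) (Icc 0 1) :=
      hcst.of_subset_closure hw continuousOn_const Ioo_subset_Icc_self
        (by rw [closure_Ioo zero_ne_one])
    intro x hx
    rw [hcst' hx, hcst' (by simp : (0 : ℝ) ∈ Icc (0 : ℝ) 1)]
  · intro ζ hζ hζc hζs
    simp only [smul_eq_mul]
    rw [key ζ hζs]
    set z := ∫ x in (0 : ℝ)..1, ζ x with hz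
    have hsub : tsupport (fun x => ζ x - z * ρ x) ⊆ Ioo (0 : ℝ) 1 := by
      refine (tsupport_sub ζ (fun x => z * ρ x)).trans (union_subset hζs ?_)
      exact (tsupport_mul_subset_right (f := fun _ => z)).trans hρs
    obtain ⟨η, h1, h2, h3, h4⟩ := exists_test_primitive (ζ := fun x => ζ x - z * ρ x)
      (hζ.sub (contDiff_const.mul hρ)) (hζc.sub (hρc.mul_left (f := fun _ => z))) hsub (by
        rw [intervalIntegral.integral_sub (hζ.continuous.intervalIntegrable _ _)
          ((hρ.continuous.intervalIntegrable _ _).const_mul z),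
          intervalIntegral.integral_const_mul, hρ1]
        simp [hz])
    have e := h η h1 h2 h3
    rw [h4] at e
    simp only [zero_mul, intervalIntegral.integral_zero, neg_zero] at e
    have e2 : ∀ x, w x * (ζ x - z * ρ x) = ζ x * w x - z * (ρ x * w x) := fun x => by ring
    simp only [e2] at e
    rw [intervalIntegral.integral_sub (hwi ζ hζ.continuous)
      ((hwi ρ hρ.continuous).const_mul z), intervalIntegral.integral_const_mul] at e
    have e3 : ∀ x, ζ x * (w x - m) = ζ x * w x - m * ζ x := fun x => by ring
    simp only [e3]
    rw [intervalIntegral.integral_sub (hwi ζ hζ.continuous)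
      ((hζ.continuous.intervalIntegrable _ _).const_mul m), intervalIntegral.integral_const_mul,
      ← hz, mul_comm m]
    exact e

theorem HasL2WeakDeriv.memLp_weakDeriv {u : ℝ → ℝ} (h : HasL2WeakDeriv u) :
    MemLp (weakDeriv u) 2 (volume.restrict (Ioo (0 : ℝ) 1)) := by
  rw [weakDeriv, dif_pos h]; exact h.choose_spec.1

theorem HasL2WeakDeriv.isWeakDeriv_weakDeriv {u : ℝ → ℝ} (h : HasL2WeakDeriv u) :
    IsWeakDeriv u (weakDeriv u) := by
  rw [weakDeriv, dif_pos h]; exact h.choose_spec.2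

theorem eq_integral_weakDeriv {χ : ℝ → ℝ} (h : χ ∈ spaceJ) :
    ∀ x ∈ Icc (0 : ℝ) 1, χ x = ∫ t in (0 : ℝ)..x, weakDeriv χ t := by
  obtain ⟨⟨-, hW⟩, hc, h0⟩ := h
  have hg := intervalIntegrable_of_memLp_two hW.memLp_weakDeriv
  set g := weakDeriv χ
  have hPc : ContinuousOn (fun x => ∫ t in (0 : ℝ)..x, g t) (Icc 0 1) := by
    have := (hg.absolutelyContinuousOnInterval_intervalIntegral (c := 0) (by simp)).continuousOn
    rwa [uIcc_of_le zero_le_one] at this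
  have := eqOn_const_of_isWeakDeriv_zero (w := fun x => χ x - ∫ t in (0 : ℝ)..x, g t)
    (hc.sub hPc) (by
      intro η hη hηc hηs
      have hd : Continuous (deriv η) := hη.continuous_deriv (by simp)
      simp only [zero_mul, intervalIntegral.integral_zero, neg_zero, sub_mul]
      rw [intervalIntegral.integral_sub, hW.isWeakDeriv_weakDeriv η hη hηc hηs,
        isWeakDeriv_primitive hg η hη hηc hηs, sub_self]
      · exact (ContinuousOn.mul (by rwa [uIcc_of_le zero_le_one])
          hd.continuousOn).intervalIntegrable
      · exact (ContinuousOn.mul (by rwa [uIcc_of_le zero_le_one])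
          hd.continuousOn).intervalIntegrable)
  intro x hx
  have e := this x hx
  simp only [h0, intervalIntegral.integral_same, sub_zero] at e
  linarith

/-- Increments grow by a factor of at most `K`; dividing `ε` by `K + 1` covers `K = 0`. This allows
the fundamental theorem of calculus for `H ∘ χ` when `χ` is only in `H¹`. -/
theorem AbsolutelyContinuousOnInterval.lipschitz_comp {f H : ℝ → ℝ} {a b : ℝ} {K : NNReal}
    (hH : LipschitzWith K H) (hf : AbsolutelyContinuousOnInterval f a b) :
    AbsolutelyContinuousOnInterval (fun x => H (f x)) a b := by
  rw [absolutelyContinuousOnInterval_iff] at hf ⊢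
  intro ε hε
  obtain ⟨δ, hδ, h⟩ := hf (ε / (K + 1)) (by positivity)
  refine ⟨δ, hδ, fun E hE hl => ?_⟩
  calc _ ≤ ∑ i ∈ Finset.range E.1, K * dist (f (E.2 i).1) (f (E.2 i).2) :=
        Finset.sum_le_sum fun i _ => hH.dist_le_mul _ _
    _ = K * ∑ i ∈ Finset.range E.1, dist (f (E.2 i).1) (f (E.2 i).2) :=
        (Finset.mul_sum _ _ _).symm
    _ ≤ (K + 1) * ∑ i ∈ Finset.range E.1, dist (f (E.2 i).1) (f (E.2 i).2) := by
        gcongr; linarith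
    _ < (K + 1) * (ε / (K + 1)) := by gcongr; exact h E hE hl
    _ = ε := by field_simp

/-- The chain rule in integrated form for `H¹` functions. -/
theorem integral_weakDeriv_mul_comp {χ H W : ℝ → ℝ} (h : χ ∈ spaceJ)
    (hd : ∀ y, HasDerivAt H (W y) y)
    {M : ℝ} (hM : ∀ y, |W y| ≤ M) :
    ∫ x in (0 : ℝ)..1, weakDeriv χ x * W (χ x) = H (χ 1) - H 0 := by
  have hg := intervalIntegrable_of_memLp_two h.1.2.memLp_weakDeriv
  have hP := hg.absolutelyContinuousOnInterval_intervalIntegral (c := 0) (by simp)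
  have hM0 : 0 ≤ M := (abs_nonneg _).trans (hM 0)
  have hL : LipschitzWith ⟨M, hM0⟩ H :=
    lipschitzWith_of_nnnorm_deriv_le (fun y => (hd y).differentiableAt) fun y => by
      rw [(hd y).deriv]; exact hM y
  have e := (hP.lipschitz_comp hL).integral_deriv_eq_sub
  have h1 := eq_integral_weakDeriv h
  simp only [intervalIntegral.integral_same] at e
  rw [← h1 1 (by simp)] at e
  rw [← e]
  apply intervalIntegral.integral_congr_ae
  filter_upwards [hg.ae_hasDerivAt_integral] with x hx hx'
  have hx2 := uIoc_subset_uIcc hx'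
  have := ((hd (∫ t in (0 : ℝ)..x, weakDeriv χ t)).comp x (hx hx2 0 (by simp))).deriv
  rw [uIcc_of_le zero_le_one] at hx2
  rw [← h1 x hx2] at this
  rw [mul_comm, ← this]
  rfl

theorem isWeakDeriv_deriv {φ : ℝ → ℝ} (h : ContDiff ℝ 1 φ) : IsWeakDeriv φ (deriv φ) := by
  intro η hη hc hs
  have h0 : η 0 = 0 := image_eq_zero_of_notMem_tsupport fun h => by simpa using hs h
  have h1 : η 1 = 0 := image_eq_zero_of_notMem_tsupport fun h => by simpa using hs h
  rw [AbsolutelyContinuousOnInterval.integral_mul_deriv_eq_deriv_mul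
    h.contDiffOn.absolutelyContinuousOnInterval
    (hη.of_le (by simp)).contDiffOn.absolutelyContinuousOnInterval, h0, h1]
  simp

theorem memLp_two_of_continuous {φ : ℝ → ℝ} (h : Continuous φ) :
    MemLp φ 2 (volume.restrict (Ioo (0 : ℝ) 1)) := by
  obtain ⟨C, hC⟩ := isCompact_Icc.exists_bound_of_continuousOn (h.continuousOn (s := Icc (0 : ℝ) 1))
  refine MemLp.of_bound h.aestronglyMeasurable C ?_
  filter_upwards [ae_restrict_mem measurableSet_Ioo] with x hx
  exact hC x (Ioo_subset_Icc_self hx)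

theorem mem_spaceJ_of_contDiff {φ : ℝ → ℝ} (h : ContDiff ℝ 1 φ) (h0 : φ 0 = 0) : φ ∈ spaceJ :=
  ⟨⟨memLp_two_of_continuous h.continuous, deriv φ,
    memLp_two_of_continuous (h.continuous_deriv le_rfl), isWeakDeriv_deriv h⟩,
    h.continuous.continuousOn, h0⟩

theorem weakDeriv_ae_eq_deriv {φ : ℝ → ℝ} (h : ContDiff ℝ 1 φ) (h0 : φ 0 = 0) :
    weakDeriv φ =ᵐ[volume.restrict (Ioo (0 : ℝ) 1)] deriv φ :=
  have hw := (mem_spaceJ_of_contDiff h h0).1.2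
  hw.isWeakDeriv_weakDeriv.ae_eq (isWeakDeriv_deriv h) hw.memLp_weakDeriv
    (memLp_two_of_continuous (h.continuous_deriv le_rfl))

/-! ### The first-order equation -/

/-- The speed of a trajectory of `φ'' = β⁻² sin φ cos φ` with first integral `c`. -/
noncomputable def speed (β c y : ℝ) : ℝ := √(c + Real.sin y ^ 2 / β ^ 2)

/-- The primitive of the speed that vanishes at `0`. -/
noncomputable def action (β c y : ℝ) : ℝ := ∫ t in (0 : ℝ)..y, speed β c t

/-- `φ` solves `φ' = √(c + β⁻² sin² φ)`, `φ(0) = 0`, and `φ'(1) = 2κ` with `φ(1) ∈ (0, π/2)`. -/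
structure IsProfile (β κ c : ℝ) (φ : ℝ → ℝ) : Prop where
  c_pos : 0 < c
  map_zero : φ 0 = 0
  map_one_pos : 0 < φ 1
  map_one_lt : φ 1 < Real.pi / 2
  first_integral : c + Real.sin (φ 1) ^ 2 / β ^ 2 = (2 * κ) ^ 2
  hasDerivAt : ∀ x, HasDerivAt φ (speed β c (φ x)) x

section speed

variable {β c : ℝ}

theorem speed_sq (hc : 0 ≤ c) (y : ℝ) : speed β c y ^ 2 = c + Real.sin y ^ 2 / β ^ 2 :=
  Real.sq_sqrt (by positivity)

theorem speed_pos (hc : 0 < c) (y : ℝ) : 0 < speed β c y := Real.sqrt_pos.2 (by positivity)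

theorem speed_nonneg (y : ℝ) : 0 ≤ speed β c y := Real.sqrt_nonneg _

theorem continuous_speed : Continuous (speed β c) := by unfold speed; fun_prop

theorem speed_le (y : ℝ) : speed β c y ≤ √(c + 1 / β ^ 2) := by
  apply Real.sqrt_le_sqrt
  gcongr
  exact Real.sin_sq_le_one y

theorem contDiff_speed (hc : 0 < c) : ContDiff ℝ ∞ (speed β c) := by
  unfold speed
  refine ContDiff.sqrt (by fun_prop) fun x => ?_
  positivity

theorem hasDerivAt_action (y : ℝ) : HasDerivAt (action β c) (speed β c y) y :=
  (continuous_speed.integral_hasStrictDerivAt 0 y).hasDerivAt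

theorem hasDerivAt_speed (hc : 0 < c) (y : ℝ) :
    HasDerivAt (speed β c) (Real.sin y * Real.cos y / β ^ 2 / speed β c y) y := by
  have h : HasDerivAt (fun y => c + Real.sin y ^ 2 / β ^ 2)
      (2 * Real.sin y * Real.cos y / β ^ 2) y := by
    have := (((Real.hasDerivAt_sin y).pow 2).div_const (β ^ 2)).const_add c
    simpa using this
  have := h.sqrt (by positivity)
  unfold speed
  convert this using 1
  ring

theorem sin_div_lt_speed (hc : 0 < c) (y : ℝ) : Real.sin y / β < speed β c y := by
  apply Real.lt_sqrt_of_sq_lt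
  rw [div_pow]
  linarith

theorem speed_le_add (hβ : 0 < β) (hc : 0 ≤ c) (y : ℝ) :
    speed β c y ≤ √c + |Real.sin y| / β := by
  apply Real.sqrt_le_iff.2 ⟨by positivity, ?_⟩
  have h1 := Real.sq_sqrt hc
  have h2 : (|Real.sin y| / β) ^ 2 = Real.sin y ^ 2 / β ^ 2 := by rw [div_pow, sq_abs]
  have h3 : 0 ≤ √c * (|Real.sin y| / β) := by positivity
  nlinarith

end speed

/-! ### Trajectories and shooting -/

/-- Existence of a global solution of `φ' = √(c + β⁻² sin² φ)`, as the inverse of the time map. -/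
theorem exists_trajectory {β c : ℝ} (hc : 0 < c) :
    ∃ φ : ℝ → ℝ, (∀ x, HasDerivAt φ (speed β c (φ x)) x) ∧
      ∀ y, φ (∫ t in (0 : ℝ)..y, (speed β c t)⁻¹) = y := by
  have hcont : Continuous fun t => (speed β c t)⁻¹ :=
    continuous_speed.inv₀ fun t => (speed_pos hc t).ne'
  set Θ : ℝ → ℝ := fun y => ∫ t in (0 : ℝ)..y, (speed β c t)⁻¹ with hΘ
  have hd : ∀ y, HasDerivAt Θ (speed β c y)⁻¹ y := fun y =>
    (hcont.integral_hasStrictDerivAt 0 y).hasDerivAt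
  have hmono : StrictMono Θ := strictMono_of_deriv_pos fun y => by
    rw [(hd y).deriv]; exact inv_pos.2 (speed_pos hc y)
  -- The time map has slope at least `m`, hence is onto, and trajectories are global.
  set m := (√(c + 1 / β ^ 2))⁻¹ with hm
  have hm0 : 0 < m := by positivity
  have hΘc : Continuous Θ := continuous_iff_continuousAt.2 fun y => (hd y).continuousAt
  have hmono2 : Monotone fun y => Θ y - m * y := monotone_of_deriv_nonneg
    (fun y => ((hd y).sub ((hasDerivAt_id y).const_mul m)).differentiableAt) fun y => by
      have e : deriv (fun y => Θ y - m * y) y = (speed β c y)⁻¹ - m * 1 :=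
        ((hd y).sub ((hasDerivAt_id y).const_mul m)).deriv
      rw [e, mul_one, sub_nonneg, hm]
      exact inv_anti₀ (speed_pos hc y) (speed_le y)
  have h0 : Θ 0 = 0 := by simp [hΘ]
  have hsurj : Function.Surjective Θ := by
    refine hΘc.surjective ?_ ?_
    · refine tendsto_atTop_mono' _ ?_ (tendsto_id.const_mul_atTop hm0)
      filter_upwards [eventually_ge_atTop 0] with y hy
      have := hmono2 hy
      simp only [h0] at this
      simp only [id]
      linarith
    · refine tendsto_atBot_mono' _ ?_ (tendsto_id.const_mul_atBot hm0)
      filter_upwards [eventually_le_atBot 0] with y hy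
      have := hmono2 hy
      simp only [h0] at this
      simp only [id]
      linarith
  set e := hmono.orderIsoOfSurjective Θ hsurj
  have hΘe : ∀ x, Θ (e.symm x) = x := fun x => e.apply_symm_apply x
  refine ⟨e.symm, fun x => ?_, fun y => e.symm_apply_apply y⟩
  have := HasDerivAt.of_local_left_inverse (f := Θ) (g := e.symm) (a := x)
    e.symm.continuous.continuousAt (hd _) (inv_pos.2 (speed_pos hc _)).ne'
    (Eventually.of_forall hΘe)
  rwa [inv_inv] at this

/-- The boundary value problem is solved by a shooting argument. -/
theorem exists_isProfile {β κ : ℝ} (hβ : 0 < β) (hκ : 0 < κ) (h : 2 * κ * β < 1) :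
    ∃ (c : ℝ) (φ : ℝ → ℝ), IsProfile β κ c φ := by
  -- Shooting is over `δ = √c` in `[δ₁, 2κ]`. With `δ = δ₁` the time to reach `βκ` is at least `β
  -- log ((δ₁ + κ)/δ₁) ≥ 1`.
  set δ₁ := κ * Real.exp (-(1 / β)) with hδ₁
  have hδ₁0 : 0 < δ₁ := by positivity
  have hδ₁κ : δ₁ ≤ κ := by
    rw [hδ₁]
    exact mul_le_of_le_one_right hκ.le (Real.exp_le_one_iff.2 (by simp; positivity))
  -- `A δ` is the angle where the speed equals `2κ`, and `T δ` the time to reach it. The truncation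
  -- by `δ₁` only serves to make `T` continuous on the whole line.
  set A : ℝ → ℝ := fun δ => Real.arcsin (β * √((2 * κ) ^ 2 - δ ^ 2)) with hA
  set T : ℝ → ℝ := fun δ =>
    ∫ t in (0 : ℝ)..A δ, (√((max δ δ₁) ^ 2 + Real.sin t ^ 2 / β ^ 2))⁻¹ with hT
  have hTc : Continuous T := by
    refine intervalIntegral.continuous_parametric_intervalIntegral_of_continuous ?_ (by fun_prop)
    change Continuous fun p : ℝ × ℝ => (√((max p.1 δ₁) ^ 2 + Real.sin p.2 ^ 2 / β ^ 2))⁻¹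
    refine Continuous.inv₀ (by fun_prop) fun p => ?_
    have : 0 < max p.1 δ₁ := lt_max_of_lt_right hδ₁0
    positivity
  have hT2 : T (2 * κ) = 0 := by simp [hT, hA]
  have hT1 : 1 ≤ T δ₁ := by
    have hlow : β * κ ≤ A δ₁ := by
      have h1 : κ ≤ √((2 * κ) ^ 2 - δ₁ ^ 2) := by
        apply Real.le_sqrt_of_sq_le
        nlinarith
      have h2 : β * κ ∈ Icc (-(Real.pi / 2)) (Real.pi / 2) := by
        constructor <;> nlinarith [Real.pi_gt_three, mul_pos hβ hκ]
      rw [← Real.arcsin_sin h2.1 h2.2]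
      apply Real.monotone_arcsin
      calc Real.sin (β * κ) ≤ β * κ := Real.sin_le (by positivity)
        _ ≤ _ := by gcongr
    have hpos : ∀ t : ℝ, 0 < √((max δ₁ δ₁) ^ 2 + Real.sin t ^ 2 / β ^ 2) := fun t => by
      rw [max_self]; positivity
    have hci : Continuous fun t => (√((max δ₁ δ₁) ^ 2 + Real.sin t ^ 2 / β ^ 2))⁻¹ :=
      Continuous.inv₀ (by fun_prop) fun t => (hpos t).ne'
    have hβκ : 0 ≤ β * κ := by positivity
    have hposd : ∀ t ∈ uIcc 0 (β * κ), 0 < δ₁ + t / β := fun t ht => by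
      rw [uIcc_of_le hβκ] at ht
      have := ht.1
      positivity
    have hder : ∀ t ∈ uIcc 0 (β * κ),
        HasDerivAt (fun t => β * Real.log (δ₁ + t / β)) ((δ₁ + t / β)⁻¹) t := fun t ht => by
      have h1 : HasDerivAt (fun t : ℝ => δ₁ + t / β) (1 / β) t :=
        ((hasDerivAt_id t).div_const β).const_add δ₁
      refine ((h1.log (hposd t ht).ne').const_mul β).congr_deriv ?_
      rw [div_div, mul_one_div, div_mul_eq_div_div, div_self hβ.ne', one_div]
    have hcd : ContinuousOn (fun t => (δ₁ + t / β)⁻¹) (uIcc 0 (β * κ)) :=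
      ContinuousOn.inv₀ (by fun_prop) fun t ht => (hposd t ht).ne'
    have hFTC := intervalIntegral.integral_eq_sub_of_hasDerivAt hder hcd.intervalIntegrable
    have hlog : 1 ≤ β * Real.log (δ₁ + β * κ / β) - β * Real.log (δ₁ + 0 / β) := by
      have e1 : Real.log δ₁ = Real.log κ - 1 / β := by
        rw [hδ₁, Real.log_mul hκ.ne' (Real.exp_pos _).ne', Real.log_exp]; ring
      have e2 : Real.log κ ≤ Real.log (δ₁ + κ) := Real.log_le_log hκ (by linarith)
      rw [zero_div, add_zero, mul_div_cancel_left₀ _ hβ.ne', e1]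
      have : β * (1 / β) = 1 := by field_simp
      nlinarith
    calc (1 : ℝ) ≤ ∫ t in (0 : ℝ)..β * κ, (δ₁ + t / β)⁻¹ := by rw [hFTC]; exact hlog
      _ ≤ ∫ t in (0 : ℝ)..β * κ, (√((max δ₁ δ₁) ^ 2 + Real.sin t ^ 2 / β ^ 2))⁻¹ := by
          refine intervalIntegral.integral_mono_on hβκ hcd.intervalIntegrable
            (hci.intervalIntegrable _ _) fun t ht => inv_anti₀ (hpos t) ?_
          rw [max_self]
          have := speed_le_add hβ (sq_nonneg δ₁) t
          rw [Real.sqrt_sq hδ₁0.le] at this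
          refine this.trans ?_
          gcongr
          exact Real.abs_sin_le_abs.trans_eq (abs_of_nonneg ht.1)
      _ ≤ T δ₁ := by
          rw [hT]
          simp only
          rw [← intervalIntegral.integral_add_adjacent_intervals
            (hci.intervalIntegrable 0 (β * κ)) (hci.intervalIntegrable (β * κ) (A δ₁))]
          linarith [intervalIntegral.integral_nonneg (μ := volume) hlow
            fun t _ => (inv_pos.2 (hpos t)).le]
  obtain ⟨δ, ⟨hδ1, hδ2⟩, hδ⟩ := intermediate_value_Icc' (by linarith : δ₁ ≤ 2 * κ)
    hTc.continuousOn (show (1 : ℝ) ∈ Icc (T (2 * κ)) (T δ₁) from ⟨by rw [hT2]; simp, hT1⟩)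
  have hδ2' : δ < 2 * κ := lt_of_le_of_ne hδ2 fun hh => by
    rw [hh, hT2] at hδ; exact zero_ne_one hδ
  have hδ0 : 0 < δ := hδ₁0.trans_le hδ1
  have hsq : 0 < (2 * κ) ^ 2 - δ ^ 2 := by nlinarith
  have hx0 : 0 < β * √((2 * κ) ^ 2 - δ ^ 2) := by positivity
  have hx1 : β * √((2 * κ) ^ 2 - δ ^ 2) < 1 := by
    have : √((2 * κ) ^ 2 - δ ^ 2) ≤ 2 * κ :=
      Real.sqrt_le_iff.2 ⟨by positivity, by nlinarith⟩
    nlinarith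
  obtain ⟨φ, hφ, hinv⟩ := exists_trajectory (β := β) (c := δ ^ 2) (by positivity)
  have h1 : φ 1 = A δ := by
    rw [← hinv (A δ), ← hδ, hT]
    simp only [max_eq_left hδ1, speed]
  refine ⟨δ ^ 2, φ, by positivity, ?_, ?_, ?_, ?_, hφ⟩
  · simpa using hinv 0
  · rw [h1]; exact Real.arcsin_pos.2 hx0
  · rw [h1]; exact Real.arcsin_lt_pi_div_two.2 hx1
  · rw [h1, hA, Real.sin_arcsin (by linarith) hx1.le, mul_pow, Real.sq_sqrt hsq.le]
    field_simp
    ring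

/-! ### Calibration and the end point function -/

/-- The calibration identity: the energy is a square plus a function of the end point value. -/
theorem energyF_eq {β κ c : ℝ} {χ : ℝ → ℝ} (hc : 0 ≤ c) (h : χ ∈ spaceJ) :
    energyF β κ χ = -c / 8 + 1 / 8 * (∫ x in (0 : ℝ)..1, (weakDeriv χ x - speed β c (χ x)) ^ 2)
      + (action β c (χ 1) - 2 * κ * χ 1) / 4 := by
  have hL := h.1.2.memLp_weakDeriv
  have hg := intervalIntegrable_of_memLp_two hL
  have hchain := integral_weakDeriv_mul_comp h (hasDerivAt_action (β := β) (c := c))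
    (M := √(c + 1 / β ^ 2)) fun y => by rw [abs_of_nonneg (speed_nonneg y)]; exact speed_le y
  have hint : ∫ x in (0 : ℝ)..1, weakDeriv χ x = χ 1 := (eq_integral_weakDeriv h 1 (by simp)).symm
  have h0 : action β c 0 = 0 := by simp [action]
  rw [h0, sub_zero] at hchain
  have hχ : ContinuousOn χ (uIcc 0 1) := by rw [uIcc_of_le zero_le_one]; exact h.2.1
  have i1 : IntervalIntegrable (fun x => weakDeriv χ x ^ 2) volume 0 1 := by
    rw [intervalIntegrable_iff_integrableOn_Ioo_of_le zero_le_one]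
    exact hL.integrable_sq
  have i2 : IntervalIntegrable (fun x => 1 / β ^ 2 * Real.sin (χ x) ^ 2) volume 0 1 :=
    ContinuousOn.intervalIntegrable
      (continuousOn_const.mul ((Real.continuous_sin.comp_continuousOn hχ).pow 2))
  have i3 : IntervalIntegrable (fun x => weakDeriv χ x * speed β c (χ x)) volume 0 1 :=
    hg.mul_continuousOn (continuous_speed.comp_continuousOn hχ)
  have e : ∀ x, (weakDeriv χ x - speed β c (χ x)) ^ 2
      = (weakDeriv χ x ^ 2 + 1 / β ^ 2 * Real.sin (χ x) ^ 2) + c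
        - 2 * (weakDeriv χ x * speed β c (χ x)) := fun x => by
    have := speed_sq (β := β) hc (χ x)
    linear_combination this
  simp only [e]
  rw [intervalIntegral.integral_sub ((i1.add i2).add intervalIntegrable_const) (i3.const_mul 2),
    intervalIntegral.integral_add (i1.add i2) intervalIntegrable_const,
    intervalIntegral.integral_const_mul, hchain, energyF, hint]
  simp only [intervalIntegral.integral_const, sub_zero, smul_eq_mul]
  ring

/-- Dropping the nonnegative integral suffices for competitors with `χ 1 < 0`, so the end point
function need only be studied on `[0, ∞)`. -/
theorem neg_mul_le_energyF {β κ : ℝ} {χ : ℝ → ℝ} (h : χ ∈ spaceJ) :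
    -(κ / 2 * χ 1) ≤ energyF β κ χ := by
  have hint : ∫ x in (0 : ℝ)..1, weakDeriv χ x = χ 1 := (eq_integral_weakDeriv h 1 (by simp)).symm
  rw [energyF, hint]
  have : 0 ≤ ∫ x in (0 : ℝ)..1, (weakDeriv χ x ^ 2 + 1 / β ^ 2 * Real.sin (χ x) ^ 2) :=
    intervalIntegral.integral_nonneg zero_le_one fun x _ => by positivity
  linarith

section action

variable {β κ c a : ℝ}

theorem action_zero : action β c 0 = 0 := by simp [action]

/-- The speed is `π`-periodic, which reduces the end point function to one period. -/
theorem action_add_pi (y : ℝ) : action β c (y + Real.pi) = action β c y + action β c Real.pi := by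
  have hp : Function.Periodic (speed β c) Real.pi := fun t => by
    simp only [speed, Real.sin_add_pi, neg_sq]
  have hi : ∀ x z, IntervalIntegrable (speed β c) volume x z := fun x z =>
    continuous_speed.intervalIntegrable x z
  have := hp.intervalIntegral_add_eq y 0
  rw [zero_add] at this
  rw [action, action, action, ← this,
    intervalIntegral.integral_add_adjacent_intervals (hi _ _) (hi _ _)]

theorem one_sub_cos_div_le_action {y : ℝ} (hc : 0 < c) (hy : 0 ≤ y) :
    (1 - Real.cos y) / β ≤ action β c y := by
  have e : ∫ t in (0 : ℝ)..y, Real.sin t / β = (1 - Real.cos y) / β := by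
    rw [intervalIntegral.integral_div, integral_sin, Real.cos_zero]
  rw [← e]
  exact intervalIntegral.integral_mono_on hy
    ((Real.continuous_sin.div_const β).intervalIntegrable _ _)
    (continuous_speed.intervalIntegrable _ _) fun t _ => (sin_div_lt_speed hc t).le

theorem action_le (hβ : 0 < β) (hc : 0 ≤ c) {y : ℝ} (hy : 0 ≤ y) (hy' : y ≤ Real.pi) :
    action β c y ≤ √c * y + (1 - Real.cos y) / β := by
  have e : ∫ t in (0 : ℝ)..y, (√c + Real.sin t / β) = √c * y + (1 - Real.cos y) / β := by
    rw [intervalIntegral.integral_add (by simp)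
      ((Real.continuous_sin.div_const β).intervalIntegrable _ _),
      intervalIntegral.integral_div, integral_sin, Real.cos_zero]
    simp [mul_comm]
  rw [← e]
  refine intervalIntegral.integral_mono_on hy (continuous_speed.intervalIntegrable _ _)
    ((continuous_const.add (Real.continuous_sin.div_const β)).intervalIntegrable _ _) fun t ht => ?_
  have := speed_le_add hβ hc t
  rwa [abs_of_nonneg (Real.sin_nonneg_of_nonneg_of_le_pi ht.1 (ht.2.trans hy'))] at this

/-- The end point function `y ↦ ∫₀^y √(c + β⁻² sin²) - 2κy` has a strict minimum over `[0, ∞)` at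
the first point where the speed is `2κ`. -/
theorem action_sub_lt (hβ : 0 < β) (hκ : 0 < κ) (h : κ < 1 / (Real.pi * β)) (hc : 0 < c)
    (ha : 0 < a) (ha' : a < Real.pi / 2) (hca : c + Real.sin a ^ 2 / β ^ 2 = (2 * κ) ^ 2)
    {y : ℝ} (hy : 0 ≤ y) (hya : y ≠ a) :
    action β c a - 2 * κ * a < action β c y - 2 * κ * y := by
  set f : ℝ → ℝ := fun y => action β c y - 2 * κ * y with hf
  have hd : ∀ y, HasDerivAt f (speed β c y - 2 * κ) y := fun y =>
    ((hasDerivAt_action y).sub ((hasDerivAt_id y).const_mul (2 * κ))).congr_deriv (by simp)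
  have hfc : Continuous f := continuous_iff_continuousAt.2 fun y => (hd y).continuousAt
  have hsa : 0 < Real.sin a := Real.sin_pos_of_pos_of_lt_pi ha (by linarith)
  have hlt : ∀ t, 0 ≤ Real.sin t → Real.sin t < Real.sin a → speed β c t < 2 * κ := by
    intro t h0 ht
    rw [speed, Real.sqrt_lt' (by positivity), ← hca]
    gcongr
  have hgt : ∀ t, Real.sin a < Real.sin t → 2 * κ < speed β c t := by
    intro t ht
    apply Real.lt_sqrt_of_sq_lt
    rw [← hca]
    gcongr
  have hanti : StrictAntiOn f (Icc 0 a) := by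
    refine strictAntiOn_of_deriv_neg (convex_Icc _ _) hfc.continuousOn fun t ht => ?_
    rw [interior_Icc] at ht
    rw [(hd t).deriv, sub_neg]
    exact hlt t (Real.sin_nonneg_of_nonneg_of_le_pi ht.1.le (by linarith [ht.2]))
      (Real.sin_lt_sin_of_lt_of_le_pi_div_two (by linarith [ht.1]) (by linarith) ht.2)
  have hmono : StrictMonoOn f (Icc a (Real.pi - a)) := by
    refine strictMonoOn_of_deriv_pos (convex_Icc _ _) hfc.continuousOn fun t ht => ?_
    rw [interior_Icc] at ht
    rw [(hd t).deriv, sub_pos]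
    apply hgt
    rcases le_total t (Real.pi / 2) with h2 | h2
    · exact Real.sin_lt_sin_of_lt_of_le_pi_div_two (by linarith) h2 ht.1
    · rw [← Real.sin_pi_sub t]
      exact Real.sin_lt_sin_of_lt_of_le_pi_div_two (by linarith) (by linarith) (by linarith [ht.2])
  have hanti2 : AntitoneOn f (Icc (Real.pi - a) Real.pi) := by
    refine antitoneOn_of_deriv_nonpos (convex_Icc _ _) hfc.continuousOn
      (fun t _ => (hd t).differentiableAt.differentiableWithinAt) fun t ht => ?_
    rw [interior_Icc] at ht
    rw [(hd t).deriv, sub_nonpos]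
    refine (hlt t (Real.sin_nonneg_of_nonneg_of_le_pi (by linarith [ht.1]) ht.2.le) ?_).le
    rw [← Real.sin_pi_sub t]
    exact Real.sin_lt_sin_of_lt_of_le_pi_div_two (by linarith [ht.2]) (by linarith)
      (by linarith [ht.1])
  have hf0 : f 0 = 0 := by simp [hf, action_zero]
  have hfa : f a < 0 := by
    rw [← hf0]; exact hanti ⟨le_rfl, ha.le⟩ ⟨ha.le, le_rfl⟩ ha
  -- The speed dominates `sin / β`, whose integral over a period is `2/β`, and `κ < 1/(πβ)` says
  -- exactly that `2/β > 2κπ`. Hence `f`, decreasing on `[π - a, π]`, stays positive there.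
  have hfpi : 0 < f Real.pi := by
    have h1 := one_sub_cos_div_le_action (β := β) hc Real.pi_pos.le
    rw [Real.cos_pi] at h1
    have h2 : 2 * κ * Real.pi < (1 - -1) / β := by
      rw [lt_div_iff₀ (by positivity)] at h ⊢
      linarith
    simp only [hf]
    linarith
  have hbase : ∀ y, 0 ≤ y → y ≤ Real.pi → y ≠ a → f a < f y := by
    intro y hy0 hyπ hne
    rcases lt_or_gt_of_ne hne with h1 | h1
    · exact hanti ⟨hy0, h1.le⟩ ⟨ha.le, le_rfl⟩ h1
    · rcases le_total y (Real.pi - a) with h2 | h2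
      · exact hmono ⟨le_rfl, by linarith⟩ ⟨h1.le, h2⟩ h1
      · exact (hfa.trans hfpi).trans_le (hanti2 ⟨h2, hyπ⟩ ⟨by linarith, le_rfl⟩ hyπ)
  -- Each further period adds `f π > 0`.
  have hstep : ∀ n : ℕ, ∀ y, 0 ≤ y → y ≤ (n + 1) * Real.pi → y ≠ a → f a < f y := by
    intro n
    induction n with
    | zero => intro y h0 h1; exact hbase y h0 (by simpa using h1)
    | succ n ih =>
      intro y h0 h1 hne
      rcases le_total y Real.pi with h2 | h2
      · exact hbase y h0 h2 hne
      · have e : f y = f (y - Real.pi) + f Real.pi := by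
          have := action_add_pi (β := β) (c := c) (y - Real.pi)
          rw [sub_add_cancel] at this
          simp only [hf, this]
          ring
        have h3 : f a ≤ f (y - Real.pi) := by
          by_cases h4 : y - Real.pi = a
          · rw [h4]
          · exact (ih _ (by linarith) (by push_cast at h1; linarith) h4).le
        linarith
  obtain ⟨n, hn⟩ := exists_nat_ge (y / Real.pi)
  refine hstep n y hy ?_ hya
  rw [div_le_iff₀ Real.pi_pos] at hn
  nlinarith [Real.pi_pos]

end action

/-! ### Minimality, uniqueness and the barrier -/

namespace IsProfile

variable {β κ c : ℝ} {φ : ℝ → ℝ}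

theorem deriv_eq (p : IsProfile β κ c φ) : deriv φ = fun x => speed β c (φ x) :=
  funext fun x => (p.hasDerivAt x).deriv

theorem contDiff (p : IsProfile β κ c φ) : ContDiff ℝ ∞ φ := by
  refine contDiff_infty.2 fun n => ?_
  induction n with
  | zero =>
    exact contDiff_zero.2
      (continuous_iff_continuousAt.2 fun x => (p.hasDerivAt x).continuousAt)
  | succ n ih =>
    push_cast
    rw [contDiff_succ_iff_deriv]
    refine ⟨fun x => (p.hasDerivAt x).differentiableAt, by simp, ?_⟩
    rw [p.deriv_eq]
    exact ((contDiff_speed p.c_pos).of_le (by exact_mod_cast le_top)).comp ih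

theorem strictMono (p : IsProfile β κ c φ) : StrictMono φ :=
  strictMono_of_deriv_pos fun x => by rw [p.deriv_eq]; exact speed_pos p.c_pos _

theorem mem_spaceJ (p : IsProfile β κ c φ) : φ ∈ spaceJ :=
  mem_spaceJ_of_contDiff (p.contDiff.of_le (by simp)) p.map_zero

theorem energyF_eq (p : IsProfile β κ c φ) :
    energyF β κ φ = -c / 8 + (action β c (φ 1) - 2 * κ * φ 1) / 4 := by
  have h1 : ContDiff ℝ 1 φ := p.contDiff.of_le (by simp)
  have : ∫ x in (0 : ℝ)..1, (weakDeriv φ x - speed β c (φ x)) ^ 2 = 0 := by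
    rw [intervalIntegral.integral_of_le zero_le_one, integral_Ioc_eq_integral_Ioo]
    apply integral_eq_zero_of_ae
    filter_upwards [weakDeriv_ae_eq_deriv h1 p.map_zero] with x hx
    rw [hx, p.deriv_eq]
    simp
  rw [_root_.energyF_eq p.c_pos.le p.mem_spaceJ, this]
  ring

theorem energyF_neg (p : IsProfile β κ c φ) (hβ : 0 < β) (hκ : 0 < κ)
    (h : κ < 1 / (Real.pi * β)) : energyF β κ φ < 0 := by
  have h1 := action_sub_lt hβ hκ h p.c_pos p.map_one_pos p.map_one_lt p.first_integral le_rfl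
    p.map_one_pos.ne
  rw [action_zero] at h1
  rw [p.energyF_eq]
  linarith [p.c_pos]

theorem isMinimizer (p : IsProfile β κ c φ) (hβ : 0 < β) (hκ : 0 < κ)
    (h : κ < 1 / (Real.pi * β)) : IsMinimizer β κ φ := by
  refine ⟨p.mem_spaceJ, fun χ hχ => ?_⟩
  rcases lt_or_ge (χ 1) 0 with hneg | hpos
  · have := neg_mul_le_energyF (β := β) (κ := κ) hχ
    have := p.energyF_neg hβ hκ h
    nlinarith
  · rw [p.energyF_eq, _root_.energyF_eq p.c_pos.le hχ]
    have h1 : 0 ≤ ∫ x in (0 : ℝ)..1, (weakDeriv χ x - speed β c (χ x)) ^ 2 :=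
      intervalIntegral.integral_nonneg zero_le_one fun x _ => sq_nonneg _
    have h2 : action β c (φ 1) - 2 * κ * φ 1 ≤ action β c (χ 1) - 2 * κ * χ 1 := by
      by_cases hne : χ 1 = φ 1
      · rw [hne]
      · exact (action_sub_lt hβ hκ h p.c_pos p.map_one_pos p.map_one_lt p.first_integral hpos
          hne).le
    linarith

/-- Equality in the calibration forces `χ 1 = φ 1` and then `χ' = speed β c (χ)` almost everywhere.
The integrated form makes `χ` a classical solution, and the speed is Lipschitz because `c > 0`. -/
theorem eqOn_of_isMinimizer (p : IsProfile β κ c φ) (hβ : 0 < β) (hκ : 0 < κ)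
    (h : κ < 1 / (Real.pi * β)) {χ : ℝ → ℝ} (hm : IsMinimizer β κ χ) : EqOn χ φ (Icc 0 1) := by
  obtain ⟨hχ, hmin⟩ := hm
  have hle := hmin φ p.mem_spaceJ
  have hpos : 0 ≤ χ 1 := by
    by_contra hneg
    have := neg_mul_le_energyF (β := β) (κ := κ) hχ
    have := p.energyF_neg hβ hκ h
    nlinarith
  have h1 : 0 ≤ ∫ x in (0 : ℝ)..1, (weakDeriv χ x - speed β c (χ x)) ^ 2 :=
    intervalIntegral.integral_nonneg zero_le_one fun x _ => sq_nonneg _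
  rw [p.energyF_eq, _root_.energyF_eq p.c_pos.le hχ] at hle
  have h2 : χ 1 = φ 1 := by
    by_contra hne
    have := action_sub_lt hβ hκ h p.c_pos p.map_one_pos p.map_one_lt p.first_integral hpos hne
    linarith
  rw [h2] at hle
  have h3 : ∫ x in (0 : ℝ)..1, (weakDeriv χ x - speed β c (χ x)) ^ 2 = 0 :=
    le_antisymm (by linarith) h1
  have hcont : ContinuousOn (fun x => speed β c (χ x)) (Icc 0 1) :=
    continuous_speed.comp_continuousOn hχ.2.1
  have hsq : MemLp (fun x => weakDeriv χ x - speed β c (χ x)) 2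
      (volume.restrict (Ioo (0 : ℝ) 1)) := by
    refine hχ.1.2.memLp_weakDeriv.sub (MemLp.of_bound
      ((hcont.mono Ioo_subset_Icc_self).aestronglyMeasurable measurableSet_Ioo) (√(c + 1 / β ^ 2))
      (Eventually.of_forall fun x => ?_))
    rw [Real.norm_of_nonneg (speed_nonneg _)]
    exact speed_le _
  have hae : weakDeriv χ =ᵐ[volume.restrict (Ioo (0 : ℝ) 1)] fun x => speed β c (χ x) := by
    rw [intervalIntegral.integral_of_le zero_le_one, integral_Ioc_eq_integral_Ioo,
      integral_eq_zero_iff_of_nonneg (fun x => sq_nonneg _) hsq.integrable_sq] at h3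
    filter_upwards [h3] with x hx
    simpa [sub_eq_zero] using hx
  have hint : ∀ x ∈ Icc (0 : ℝ) 1, χ x = ∫ t in (0 : ℝ)..x, speed β c (χ t) := by
    intro x hx
    rw [eq_integral_weakDeriv hχ x hx]
    apply intervalIntegral.integral_congr_ae
    rw [EventuallyEq, ae_restrict_iff' measurableSet_Ioo] at hae
    have h1 : ∀ᵐ t : ℝ, t ≠ 1 := by simp [ae_iff, measure_singleton]
    filter_upwards [hae, h1] with t ht ht1 ht'
    rw [uIoc_of_le hx.1] at ht'
    exact ht ⟨ht'.1, lt_of_le_of_ne (ht'.2.trans hx.2) ht1⟩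
  have hder : ∀ x ∈ Ico (0 : ℝ) 1, HasDerivWithinAt χ (speed β c (χ x)) (Ici x) x := by
    intro x hx
    have hd : HasDerivWithinAt (fun x => ∫ t in (0 : ℝ)..x, speed β c (χ t)) (speed β c (χ x))
        (Icc x 1) x := by
      have hsub : Icc x 1 ⊆ Icc 0 1 := Icc_subset_Icc_left hx.1
      have : Fact (x ∈ Icc x 1) := ⟨⟨le_rfl, hx.2.le⟩⟩
      refine intervalIntegral.integral_hasDerivWithinAt_right
        ((hcont.mono ?_).intervalIntegrable) (t := Icc x 1) ?_ ?_
      · rw [uIcc_of_le hx.1]; exact Icc_subset_Icc_right hx.2.le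
      · exact ⟨Icc x 1, self_mem_nhdsWithin,
          (hcont.mono hsub).aestronglyMeasurable measurableSet_Icc⟩
      · exact (hcont.mono hsub) x ⟨le_rfl, hx.2.le⟩
    have hd2 : HasDerivWithinAt χ (speed β c (χ x)) (Icc x 1) x :=
      hd.congr (fun y hy => hint y ⟨hx.1.trans hy.1, hy.2⟩) (hint x ⟨hx.1, hx.2.le⟩)
    exact hd2.mono_of_mem_nhdsWithin (Icc_mem_nhdsGE hx.2)
  obtain ⟨K, hK⟩ : ∃ K, LipschitzWith K (speed β c) := by
    refine ⟨(1 / β ^ 2 / √c).toNNReal, lipschitzWith_of_nnnorm_deriv_le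
      (fun y => (hasDerivAt_speed p.c_pos y).differentiableAt) fun y => ?_⟩
    rw [(hasDerivAt_speed p.c_pos y).deriv, ← NNReal.coe_le_coe, coe_nnnorm, Real.norm_eq_abs,
      Real.coe_toNNReal _ (by positivity)]
    rw [abs_div, abs_div, abs_of_pos (speed_pos p.c_pos y), abs_mul, abs_of_pos (sq_pos_of_pos hβ)]
    have hs : √c ≤ speed β c y := Real.sqrt_le_sqrt
      (by linarith [show 0 ≤ Real.sin y ^ 2 / β ^ 2 by positivity])
    have hc' : 0 < √c := Real.sqrt_pos.2 p.c_pos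
    have hm : |Real.sin y| * |Real.cos y| ≤ 1 :=
      mul_le_one₀ (Real.abs_sin_le_one y) (abs_nonneg _) (Real.abs_cos_le_one y)
    gcongr
  refine ODE_solution_unique_of_mem_Icc_right (v := fun _ => speed β c) (s := fun _ => univ)
    (fun _ _ => hK.lipschitzOnWith) hχ.2.1 hder (fun _ _ => trivial)
    p.contDiff.continuous.continuousOn (fun x _ => (p.hasDerivAt x).hasDerivWithinAt)
    (fun _ _ => trivial) ?_
  rw [hχ.2.2, p.map_zero]

/-- The exponential upper barrier. -/
theorem lt_barrier (p : IsProfile β κ c φ) (hβ : 0 < β) {x : ℝ} (hx : x ∈ Ico (0 : ℝ) 1) :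
    φ x < 2 * Real.arctan (Real.tan (φ 1 / 2) * Real.exp ((x - 1) / β)) := by
  have hlt := p.map_one_lt
  have hrange : ∀ y ∈ Icc (0 : ℝ) 1, 0 ≤ φ y ∧ φ y ≤ φ 1 := fun y hy =>
    ⟨p.map_zero ▸ p.strictMono.monotone hy.1, p.strictMono.monotone hy.2⟩
  have hcos : ∀ y ∈ Icc (0 : ℝ) 1, 0 < Real.cos (φ y / 2) := fun y hy =>
    Real.cos_pos_of_mem_Ioo ⟨by linarith [(hrange y hy).1, Real.pi_pos], by
      linarith [(hrange y hy).2, Real.pi_pos]⟩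
  -- The barrier makes this product constant; for `φ` the derivative has the sign of `speed - sin /
  -- β`, which is positive as `c > 0`.
  have hd : ∀ y ∈ Icc (0 : ℝ) 1, HasDerivAt (fun y => Real.tan (φ y / 2) * Real.exp (-y / β))
      (Real.exp (-y / β) / (2 * Real.cos (φ y / 2) ^ 2) *
        (speed β c (φ y) - Real.sin (φ y) / β)) y := by
    intro y hy
    have hc := (hcos y hy).ne'
    have h1 := (Real.hasDerivAt_tan hc).comp y ((p.hasDerivAt y).div_const 2)
    have h2 := (((hasDerivAt_id y).neg).div_const β).exp
    refine (h1.mul h2).congr_deriv ?_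
    have e : Real.sin (φ y) = 2 * Real.sin (φ y / 2) * Real.cos (φ y / 2) := by
      rw [← Real.sin_two_mul]; ring_nf
    simp only [id, Pi.neg_apply, Function.comp, Real.tan_eq_sin_div_cos]
    rw [e]
    field_simp
    ring
  have hmono : StrictMonoOn (fun y => Real.tan (φ y / 2) * Real.exp (-y / β)) (Icc 0 1) := by
    refine strictMonoOn_of_deriv_pos (convex_Icc _ _)
      (fun y hy => (hd y hy).continuousAt.continuousWithinAt) fun y hy => ?_
    rw [interior_Icc] at hy
    have hy' := Ioo_subset_Icc_self hy
    rw [(hd y hy').deriv]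
    have := hcos y hy'
    have := sub_pos.2 (sin_div_lt_speed (β := β) p.c_pos (φ y))
    positivity
  have hx' : x ∈ Icc (0 : ℝ) 1 := ⟨hx.1, hx.2.le⟩
  have hlt2 := hmono hx' (by simp : (1 : ℝ) ∈ Icc (0 : ℝ) 1) hx.2
  have hlt3 : Real.tan (φ x / 2) < Real.tan (φ 1 / 2) * Real.exp ((x - 1) / β) := by
    have e1 : Real.exp ((x - 1) / β) = Real.exp (-1 / β) * Real.exp (x / β) := by
      rw [← Real.exp_add]; ring_nf
    have e2 : Real.exp (-x / β) * Real.exp (x / β) = 1 := by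
      rw [← Real.exp_add, ← Real.exp_zero]; ring_nf
    simp only at hlt2
    calc Real.tan (φ x / 2) = Real.tan (φ x / 2) * Real.exp (-x / β) * Real.exp (x / β) := by
          rw [mul_assoc, e2, mul_one]
      _ < Real.tan (φ 1 / 2) * Real.exp (-1 / β) * Real.exp (x / β) := by gcongr
      _ = _ := by rw [e1]; ring
  have := Real.arctan_strictMono hlt3
  rw [Real.arctan_tan (by linarith [(hrange x hx').1, Real.pi_pos])
    (by linarith [(hrange x hx').2, Real.pi_pos])] at this
  linarith

end IsProfile

/-! ### Exponential smallness and the energy expansion -/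

theorem two_mul_mul_lt_one {β κ : ℝ} (hβ : 0 < β) (h : κ < 1 / (Real.pi * β)) :
    κ * β < 1 / Real.pi ∧ 2 * κ * β < 1 := by
  have hπ := Real.pi_gt_three
  rw [lt_div_iff₀ (by positivity)] at h
  have h1 : κ * β < 1 / Real.pi := by rw [lt_div_iff₀ (by positivity)]; linarith
  have : 1 / Real.pi < 1 / 3 := by gcongr
  exact ⟨h1, by linarith⟩

/-- `tan (a/2) = sin a / (1 + cos a)` and `cos a ≥ 0`. This turns the barrier into a bound linear in
`κβ`. -/
theorem tan_half_le_sin {a : ℝ} (h0 : 0 ≤ a) (h1 : a ≤ Real.pi / 2) :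
    Real.tan (a / 2) ≤ Real.sin a := by
  have hπ := Real.pi_pos
  have hc : 0 < Real.cos (a / 2) := Real.cos_pos_of_mem_Ioo ⟨by linarith, by linarith⟩
  have hs : 0 ≤ Real.sin (a / 2) := Real.sin_nonneg_of_nonneg_of_le_pi (by linarith) (by linarith)
  have h2 : Real.cos a = 2 * Real.cos (a / 2) ^ 2 - 1 := by
    rw [← Real.cos_two_mul]; ring_nf
  have h3 : Real.sin a = 2 * Real.sin (a / 2) * Real.cos (a / 2) := by
    rw [← Real.sin_two_mul]; ring_nf
  have h4 : 0 ≤ Real.cos a := Real.cos_nonneg_of_mem_Icc ⟨by linarith, h1⟩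
  rw [Real.tan_eq_sin_div_cos, div_le_iff₀ hc, h3]
  nlinarith

theorem arctan_le_self_of_nonneg {y : ℝ} (hy : 0 ≤ y) : Real.arctan y ≤ y :=
  (Real.le_tan (Real.arctan_nonneg.2 hy) (Real.arctan_lt_pi_div_two y)).trans_eq (Real.tan_arctan y)

/-- Jordan's inequality `(2/π) t ≤ sin t`, with `π ≤ 4`. -/
theorem arcsin_le_mul {x : ℝ} (h0 : 0 ≤ x) (h1 : x ≤ 1) : Real.arcsin x ≤ 2 * x := by
  have h := Real.mul_le_sin (Real.arcsin_nonneg.2 h0) (Real.arcsin_le_pi_div_two x)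
  rw [Real.sin_arcsin (by linarith) h1] at h
  have hπ : 1 / 2 ≤ 2 / Real.pi := by
    rw [div_le_div_iff₀ two_pos Real.pi_pos]; linarith [Real.pi_le_four]
  nlinarith [Real.arcsin_nonneg.2 h0]

namespace IsProfile

variable {β κ c : ℝ} {φ : ℝ → ℝ}

theorem sin_map_one_pos (p : IsProfile β κ c φ) : 0 < Real.sin (φ 1) :=
  Real.sin_pos_of_pos_of_lt_pi p.map_one_pos (by linarith [p.map_one_lt, Real.pi_pos])

theorem sin_map_one_sq (p : IsProfile β κ c φ) (hβ : 0 < β) :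
    Real.sin (φ 1) ^ 2 = (2 * κ * β) ^ 2 - β ^ 2 * c := by
  have := p.first_integral
  field_simp at this
  linarith

theorem sin_map_one_le (p : IsProfile β κ c φ) (hβ : 0 < β) (hκ : 0 < κ) :
    Real.sin (φ 1) ≤ 2 * κ * β := by
  have := p.sin_map_one_sq hβ
  have : 0 < β ^ 2 * c := mul_pos (by positivity) p.c_pos
  exact (abs_le_of_sq_le_sq' (by linarith) (by positivity)).2

theorem speed_map_one (p : IsProfile β κ c φ) (hκ : 0 < κ) : speed β c (φ 1) = 2 * κ := by
  rw [speed, p.first_integral, Real.sqrt_sq (by positivity)]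

theorem map_nonneg (p : IsProfile β κ c φ) {x : ℝ} (hx : 0 ≤ x) : 0 ≤ φ x :=
  p.map_zero ▸ p.strictMono.monotone hx

/-- Exponential decay away from the end point `1`. -/
theorem map_le (p : IsProfile β κ c φ) (hβ : 0 < β) (hκ : 0 < κ) {x : ℝ}
    (hx : x ∈ Icc (0 : ℝ) 1) : φ x ≤ 4 * κ * β * Real.exp ((x - 1) / β) := by
  have hπ := Real.pi_pos
  have h1 := tan_half_le_sin p.map_one_pos.le p.map_one_lt.le
  have h2 := p.sin_map_one_le hβ hκ
  have ht : 0 ≤ Real.tan (φ 1 / 2) :=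
    Real.tan_nonneg_of_nonneg_of_le_pi_div_two (by linarith [p.map_one_pos])
      (by linarith [p.map_one_lt])
  have h3 : φ x ≤ 2 * Real.arctan (Real.tan (φ 1 / 2) * Real.exp ((x - 1) / β)) := by
    rcases hx.2.lt_or_eq with h | h
    · exact (p.lt_barrier hβ ⟨hx.1, h⟩).le
    · rw [h, sub_self, zero_div, Real.exp_zero, mul_one,
        Real.arctan_tan (by linarith [p.map_one_pos]) (by linarith [p.map_one_lt])]
      linarith
  have h4 : Real.arctan (Real.tan (φ 1 / 2) * Real.exp ((x - 1) / β)) ≤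
      Real.tan (φ 1 / 2) * Real.exp ((x - 1) / β) := arctan_le_self_of_nonneg (by positivity)
  have h5 : Real.tan (φ 1 / 2) * Real.exp ((x - 1) / β) ≤
      2 * κ * β * Real.exp ((x - 1) / β) := by gcongr; linarith
  linarith

/-- Since `φ' ≥ √c`, one has `√c / 2 ≤ φ (1/2)`, and the value at `1/2` is exponentially small by
the barrier. -/
theorem sqrt_le (p : IsProfile β κ c φ) (hβ : 0 < β) (hκ : 0 < κ) :
    √c ≤ 8 * κ * β * Real.exp (-(1 / 2 / β)) := by
  have hm : Monotone fun x => φ x - √c * x := monotone_of_deriv_nonneg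
    (fun x => ((p.hasDerivAt x).sub ((hasDerivAt_id x).const_mul √c)).differentiableAt) fun x => by
      have e : deriv (fun x => φ x - √c * x) x = speed β c (φ x) - √c * 1 :=
        ((p.hasDerivAt x).sub ((hasDerivAt_id x).const_mul √c)).deriv
      rw [e, mul_one, sub_nonneg]
      exact Real.sqrt_le_sqrt
        (by linarith [show 0 ≤ Real.sin (φ x) ^ 2 / β ^ 2 by positivity])
  have h1 := hm (show (0 : ℝ) ≤ 1 / 2 by norm_num)
  have h2 := p.map_le hβ hκ (x := 1 / 2) ⟨by norm_num, by norm_num⟩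
  have e : ((1 / 2 : ℝ) - 1) / β = -(1 / 2 / β) := by ring
  rw [e] at h2
  simp only [p.map_zero] at h1
  linarith

theorem c_le (p : IsProfile β κ c φ) (hβ : 0 < β) (hκ : 0 < κ) :
    c ≤ 64 * (κ * β) ^ 2 * Real.exp (-(1 / 2 / β)) := by
  have h1 := p.sqrt_le hβ hκ
  have h2 : Real.exp (-(1 / 2 / β)) ≤ 1 := Real.exp_le_one_iff.2 (by simp; positivity)
  have h3 := Real.exp_pos (-(1 / 2 / β))
  rw [← Real.sq_sqrt p.c_pos.le]
  calc √c ^ 2 ≤ (8 * κ * β * Real.exp (-(1 / 2 / β))) ^ 2 := by gcongr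
    _ = 64 * (κ * β) ^ 2 * (Real.exp (-(1 / 2 / β)) * Real.exp (-(1 / 2 / β))) := by ring
    _ ≤ 64 * (κ * β) ^ 2 * (Real.exp (-(1 / 2 / β)) * 1) := by gcongr
    _ = _ := by ring

/-- The minimal energy, up to an exponentially small relative error. -/
theorem abs_energyF_sub_le (p : IsProfile β κ c φ) (hβ : 0 < β) (hκ : 0 < κ)
    (h : κ < 1 / (Real.pi * β)) :
    |energyF β κ φ - ((1 - √(1 - 4 * (κ * β) ^ 2)) / (4 * β)
      - κ * β / (2 * β) * Real.arcsin (2 * (κ * β)))| ≤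
      16 * (κ * β) ^ 2 * Real.exp (-(1 / 2 / β)) := by
  have hk := (two_mul_mul_lt_one hβ h).2
  have hk0 : 0 < κ * β := by positivity
  have hπ := Real.pi_pos
  set a₀ := Real.arcsin (2 * (κ * β)) with ha₀
  have ha0 : 0 ≤ a₀ := Real.arcsin_nonneg.2 (by positivity)
  have ha1 : a₀ ≤ Real.pi / 2 := Real.arcsin_le_pi_div_two _
  have ha2 : a₀ ≤ 4 * (κ * β) := by
    have := arcsin_le_mul (x := 2 * (κ * β)) (by positivity) (by linarith)
    linarith
  have hsin : Real.sin a₀ = 2 * (κ * β) := Real.sin_arcsin (by linarith) (by linarith)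
  have hcos : √(1 - 4 * (κ * β) ^ 2) = Real.cos a₀ := by
    rw [ha₀, Real.cos_arcsin]; ring_nf
  have hal : φ 1 ≤ a₀ := by
    rw [← Real.arcsin_sin (x := φ 1) (by linarith [p.map_one_pos]) p.map_one_lt.le]
    exact Real.monotone_arcsin (by linarith [p.sin_map_one_le hβ hκ])
  have hpos := p.map_one_pos
  -- At `c = 0` the end point function is `(1 - cos y)/β - 2κy`, with critical point `a₀`. Its value
  -- at `φ 1` is at least that at `a₀`, which bounds the energy from below; minimality of `φ 1` for
  -- the true function, tested at `a₀`, bounds it from above.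
  have hlow : Real.cos (φ 1) - Real.cos a₀ ≤ 2 * (κ * β) * (a₀ - φ 1) := by
    rw [← hsin, Real.cos_sub_cos]
    have e1 : Real.sin ((φ 1 + a₀) / 2) ≤ Real.sin a₀ :=
      Real.sin_le_sin_of_le_of_le_pi_div_two (by linarith) ha1 (by linarith)
    have e2 : Real.sin ((a₀ - φ 1) / 2) ≤ (a₀ - φ 1) / 2 := Real.sin_le (by linarith)
    have e3 : 0 ≤ Real.sin a₀ := by rw [hsin]; positivity
    have e4 : 0 ≤ Real.sin ((a₀ - φ 1) / 2) :=
      Real.sin_nonneg_of_nonneg_of_le_pi (by linarith) (by linarith)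
    have e5 : Real.sin ((φ 1 - a₀) / 2) = -Real.sin ((a₀ - φ 1) / 2) := by
      rw [← Real.sin_neg]; ring_nf
    rw [e5]
    nlinarith [mul_le_mul e1 e2 e4 e3]
  have hE := p.energyF_eq
  have h1 := one_sub_cos_div_le_action (β := β) p.c_pos p.map_one_pos.le
  have h2 : action β c (φ 1) - 2 * κ * φ 1 ≤ action β c a₀ - 2 * κ * a₀ := by
    by_cases hne : a₀ = φ 1
    · rw [hne]
    · exact (action_sub_lt hβ hκ h p.c_pos p.map_one_pos p.map_one_lt p.first_integral ha0 hne).le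
  have h3 := action_le hβ p.c_pos.le ha0 (by linarith)
  have h4 : (1 - Real.cos a₀) / β - 2 * κ * a₀ ≤ (1 - Real.cos (φ 1)) / β - 2 * κ * φ 1 := by
    have : (Real.cos (φ 1) - Real.cos a₀) / β ≤ 2 * κ * (a₀ - φ 1) := by
      rw [div_le_iff₀ hβ]; linarith
    have e : (1 - Real.cos a₀) / β = (1 - Real.cos (φ 1)) / β
      + (Real.cos (φ 1) - Real.cos a₀) / β := by ring
    linarith
  have hc := p.c_le hβ hκ
  have hs : √c * a₀ ≤ 8 * κ * β * Real.exp (-(1 / 2 / β)) * (4 * (κ * β)) :=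
    mul_le_mul (p.sqrt_le hβ hκ) ha2 ha0 (by positivity)
  have htar : (1 - √(1 - 4 * (κ * β) ^ 2)) / (4 * β) - κ * β / (2 * β) * a₀
      = ((1 - Real.cos a₀) / β - 2 * κ * a₀) / 4 := by
    rw [hcos]; field_simp; ring
  have hX := Real.exp_pos (-(1 / 2 / β))
  have hY : 0 < (κ * β) ^ 2 * Real.exp (-(1 / 2 / β)) := by positivity
  have hc0 := p.c_pos
  rw [htar, abs_le]
  constructor <;> nlinarith

end IsProfile

theorem tendsto_exp_neg_div_div_pow {δ : ℝ} (hδ : 0 < δ) (n : ℕ) :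
    Tendsto (fun β : ℝ => Real.exp (-(δ / β)) / β ^ n) (𝓝[>] 0) (𝓝 0) := by
  have h := (tendsto_rpow_mul_exp_neg_mul_atTop_nhds_zero (n : ℝ) δ hδ).comp tendsto_inv_nhdsGT_zero
  refine h.congr fun β => ?_
  simp only [Function.comp, Real.rpow_natCast]
  rw [inv_pow, div_eq_mul_inv, mul_comm, neg_mul, div_eq_mul_inv]

/-! ### The pendulum equation and continuous dependence -/

/-- `u ↦ sin(2λu) / (2λ)`, extended by `u` to `λ = 0`. -/
noncomputable def pendulumForce (l u : ℝ) : ℝ := u * Real.sinc (2 * l * u)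

/-- `u` solves `u'' = sin(2λu) / (2λ)` with `v = u'`. -/
def IsPendulum (l : ℝ) (u v : ℝ → ℝ) : Prop :=
  ∀ y, HasDerivAt u (v y) y ∧ HasDerivAt v (pendulumForce l (u y)) y

theorem pendulumForce_zero (u : ℝ) : pendulumForce 0 u = u := by simp [pendulumForce]

theorem pendulumForce_of_ne_zero {l : ℝ} (hl : l ≠ 0) (u : ℝ) :
    pendulumForce l u = Real.sin (2 * l * u) / (2 * l) := by
  rcases eq_or_ne u 0 with rfl | hu
  · simp [pendulumForce]
  · rw [pendulumForce, Real.sinc_of_ne_zero (by positivity)]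
    field_simp

theorem continuous_pendulumForce : Continuous fun q : ℝ × ℝ => pendulumForce q.1 q.2 := by
  unfold pendulumForce
  exact continuous_snd.mul (Real.continuous_sinc.comp (by fun_prop))

theorem hasDerivAt_pendulumForce (l u : ℝ) :
    HasDerivAt (pendulumForce l) (Real.cos (2 * l * u)) u := by
  rcases eq_or_ne l 0 with rfl | hl
  · rw [show pendulumForce 0 = id from funext pendulumForce_zero]
    simpa using hasDerivAt_id u
  · rw [show pendulumForce l = fun u => Real.sin (2 * l * u) / (2 * l) from
      funext (pendulumForce_of_ne_zero hl)]
    have h1 : HasDerivAt (fun u : ℝ => 2 * l * u) (2 * l) u := by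
      simpa using (hasDerivAt_id u).const_mul (2 * l)
    refine (h1.sin.div_const (2 * l)).congr_deriv ?_
    field_simp

theorem lipschitzWith_pendulumForce (l : ℝ) : LipschitzWith 1 (pendulumForce l) :=
  lipschitzWith_of_nnnorm_deriv_le (fun u => (hasDerivAt_pendulumForce l u).differentiableAt)
    fun u => by
      rw [(hasDerivAt_pendulumForce l u).deriv]
      exact Real.abs_cos_le_one _

/-- The constant does not depend on `l`, so the Grönwall bound below is uniform as `l` varies. -/
theorem lipschitzWith_pendulumField (l : ℝ) :
    LipschitzWith 1 fun q : ℝ × ℝ => (q.2, pendulumForce l q.1) := by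
  have := LipschitzWith.prodMk (LipschitzWith.prod_snd (α := ℝ) (β := ℝ))
    ((lipschitzWith_pendulumForce l).comp LipschitzWith.prod_fst)
  simpa using this

theorem IsPendulum.hasDerivAt_cos {l : ℝ} {u v : ℝ → ℝ} (h : IsPendulum l u v) (y : ℝ) :
    HasDerivAt (fun y => Real.cos (2 * l * u y))
      (-(4 * l ^ 2) * pendulumForce l (u y) * v y) y := by
  have h1 := ((h y).1.const_mul (2 * l)).cos
  refine h1.congr_deriv ?_
  rcases eq_or_ne l 0 with rfl | hl
  · simp
  · rw [pendulumForce_of_ne_zero hl]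
    field_simp
    ring

/-- The derivatives of a pendulum are continuous functions of position, velocity and `λ`. -/
theorem exists_jet (k : ℕ) : ∃ G : ℝ × ℝ × ℝ → ℝ, Continuous G ∧
    ∀ l u v, IsPendulum l u v → ∀ y, iteratedDeriv k u y = G (u y, v y, l) := by
  -- The force, `cos (2λu)`, `v` and `4λ²` form a system closed under differentiation in `y`,
  -- including at `λ = 0`. Thus `P` is differentiated but the force never is in `λ`. The count
  -- starts at `k + 1` because `u` itself is not in the list.
  suffices H : ∀ k : ℕ, ∃ P : ℝ × ℝ × ℝ × ℝ → ℝ, ContDiff ℝ ∞ P ∧ ∀ l u v, IsPendulum l u v →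
      ∀ y, iteratedDeriv (k + 1) u y
        = P (pendulumForce l (u y), Real.cos (2 * l * u y), v y, 4 * l ^ 2) by
    cases k with
    | zero => exact ⟨Prod.fst, continuous_fst, fun l u v _ y => by simp⟩
    | succ k =>
      obtain ⟨P, hP, h⟩ := H k
      refine ⟨fun q => P (pendulumForce q.2.2 q.1, Real.cos (2 * q.2.2 * q.1), q.2.1,
        4 * q.2.2 ^ 2), ?_, h⟩
      refine hP.continuous.comp (Continuous.prodMk ?_ (by fun_prop))
      exact continuous_pendulumForce.comp (f := fun q : ℝ × ℝ × ℝ => (q.2.2, q.1)) (by fun_prop)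
  intro k
  induction k with
  | zero =>
    exact ⟨fun q => q.2.2.1, by fun_prop, fun l u v h y => by
      rw [zero_add, iteratedDeriv_one, (h y).1.deriv]⟩
  | succ k ih =>
    obtain ⟨P, hP, hk⟩ := ih
    refine ⟨fun q => fderiv ℝ P q (q.2.1 * q.2.2.1, -q.2.2.2 * q.1 * q.2.2.1, q.1, 0), ?_, ?_⟩
    · exact (hP.fderiv_right (m := ∞) (by simp)).clm_apply (by fun_prop)
    · intro l u v h y
      rw [iteratedDeriv_succ, funext (hk l u v h)]
      have h1 := (hasDerivAt_pendulumForce l (u y)).comp y (h y).1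
      have h2 := h1.prodMk ((h.hasDerivAt_cos y).prodMk
        ((h y).2.prodMk (hasDerivAt_const y (4 * l ^ 2))))
      exact ((hP.differentiable (by simp) _).hasFDerivAt.comp_hasDerivAt y h2).deriv

/-- On a compact set, uniform convergence to a continuous function is continuous convergence. -/
theorem tendstoUniformlyOn_iff_forall_tendsto_prod {ι α E : Type*} [TopologicalSpace α]
    [UniformSpace E] {F : ι → α → E} {f : α → E} {l : Filter ι} {K : Set α} (hK : IsCompact K)
    (hf : ContinuousOn f K) :
    TendstoUniformlyOn F f l K ↔
      ∀ x ∈ K, Tendsto (fun q : ι × α => F q.1 q.2) (l ×ˢ 𝓝[K] x) (𝓝 (f x)) := by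
  rw [← tendstoLocallyUniformlyOn_iff_tendstoUniformlyOn_of_compact hK,
    tendstoLocallyUniformlyOn_iff_forall_tendsto]
  refine forall₂_congr fun x hx => ?_
  have hfx : Tendsto (fun q : ι × α => f q.2) (l ×ˢ 𝓝[K] x) (𝓝 (f x)) :=
    Tendsto.comp (hf x hx) tendsto_snd
  exact ⟨fun h => hfx.congr_uniformity h, fun h =>
    (hfx.prodMk_nhds h).mono_right (nhds_le_uniformity _)⟩

theorem IsPendulum.continuous {l : ℝ} {u v : ℝ → ℝ} (h : IsPendulum l u v) :
    Continuous u ∧ Continuous v :=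
  ⟨continuous_iff_continuousAt.2 fun y => (h y).1.continuousAt,
    continuous_iff_continuousAt.2 fun y => (h y).2.continuousAt⟩

/-- Continuous dependence of pendulums on the initial data and on `λ`. -/
theorem tendstoUniformlyOn_of_isPendulum {ι : Type*} {F : Filter ι} {l : ι → ℝ} {u v : ι → ℝ → ℝ}
    {l₀ : ℝ} {u₀ v₀ : ℝ → ℝ} (h : ∀ᶠ i in F, IsPendulum (l i) (u i) (v i))
    (h₀ : IsPendulum l₀ u₀ v₀) (hl : Tendsto l F (𝓝 l₀))
    (hu : Tendsto (fun i => u i 0) F (𝓝 (u₀ 0))) (hv : Tendsto (fun i => v i 0) F (𝓝 (v₀ 0)))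
    {R : ℝ} :
    TendstoUniformlyOn (fun i y => (u i y, v i y)) (fun y => (u₀ y, v₀ y)) F (Icc 0 R) := by
  have hforce : TendstoUniformlyOn (fun i y => pendulumForce (l i) (u₀ y))
      (fun y => pendulumForce l₀ (u₀ y)) F (Icc 0 R) := by
    have hc : Continuous fun y => pendulumForce l₀ (u₀ y) :=
      continuous_pendulumForce.comp (continuous_const.prodMk h₀.continuous.1)
    rw [tendstoUniformlyOn_iff_forall_tendsto_prod isCompact_Icc hc.continuousOn]
    intro x _
    refine (continuous_pendulumForce.tendsto (l₀, u₀ x)).comp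
      (Tendsto.prodMk_nhds (hl.comp tendsto_fst) ?_)
    exact (h₀.continuous.1.continuousAt.mono_left nhdsWithin_le_nhds).comp tendsto_snd
  rw [Metric.tendstoUniformlyOn_iff] at hforce ⊢
  intro ε hε
  -- Grönwall with constant one gives `η e^y + η (e^y - 1) < 2 η e^R = ε`. The limit trajectory is
  -- treated as an approximate solution for the parameter `l i`, so the forces are compared only
  -- along the fixed curve `u₀`.
  set η := ε / (2 * Real.exp R) with hη
  have hη0 : 0 < η := by positivity
  filter_upwards [h, hforce η hη0, Metric.tendsto_nhds.1 hu η hη0, Metric.tendsto_nhds.1 hv η hη0]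
    with i hi hf hu hv y hy
  have hG := dist_le_of_approx_trajectories_ODE (K := 1) (a := 0) (b := R) (δ := η) (εf := η)
    (εg := 0)
    (v := fun _ (q : ℝ × ℝ) => (q.2, pendulumForce (l i) q.1))
    (f := fun y => (u₀ y, v₀ y)) (f' := fun y => (v₀ y, pendulumForce l₀ (u₀ y)))
    (g := fun y => (u i y, v i y)) (g' := fun y => (v i y, pendulumForce (l i) (u i y)))
    (fun _ => lipschitzWith_pendulumField (l i))
    (h₀.continuous.1.prodMk h₀.continuous.2).continuousOn
    (fun t _ => ((h₀ t).1.prodMk (h₀ t).2).hasDerivWithinAt)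
    (fun t ht => by
      rw [Prod.dist_eq, dist_self]
      exact max_le hη0.le (hf t (Ico_subset_Icc_self ht)).le)
    (hi.continuous.1.prodMk hi.continuous.2).continuousOn
    (fun t _ => ((hi t).1.prodMk (hi t).2).hasDerivWithinAt)
    (fun t _ => by rw [dist_self])
    (by
      rw [dist_comm, Prod.dist_eq]
      exact max_le hu.le hv.le) y hy
  refine hG.trans_lt ?_
  rw [gronwallBound_of_K_ne_0 (by simp)]
  simp only [NNReal.coe_one, one_mul, sub_zero, add_zero, div_one]
  have h1 : Real.exp y ≤ Real.exp R := Real.exp_le_exp.2 hy.2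
  have h2 : η * (2 * Real.exp R) = ε := by rw [hη]; field_simp
  nlinarith

/-- Smooth dependence: all derivatives converge, uniformly on compact sets. -/
theorem tendstoUniformlyOn_iteratedDeriv {ι : Type*} {F : Filter ι} {l : ι → ℝ} {u v : ι → ℝ → ℝ}
    {l₀ : ℝ} {u₀ v₀ : ℝ → ℝ} (h : ∀ᶠ i in F, IsPendulum (l i) (u i) (v i))
    (h₀ : IsPendulum l₀ u₀ v₀) (hl : Tendsto l F (𝓝 l₀))
    (hu : Tendsto (fun i => u i 0) F (𝓝 (u₀ 0))) (hv : Tendsto (fun i => v i 0) F (𝓝 (v₀ 0)))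
    {R : ℝ} (k : ℕ) :
    TendstoUniformlyOn (fun i => iteratedDeriv k (u i)) (iteratedDeriv k u₀) F (Icc 0 R) := by
  obtain ⟨G, hG, hjet⟩ := exists_jet k
  have hU := tendstoUniformlyOn_of_isPendulum h h₀ hl hu hv (R := R)
  have hc0 := h₀.continuous.1.prodMk h₀.continuous.2
  rw [tendstoUniformlyOn_iff_forall_tendsto_prod isCompact_Icc hc0.continuousOn] at hU
  have e₀ : iteratedDeriv k u₀ = fun y => G (u₀ y, v₀ y, l₀) := funext (hjet _ _ _ h₀)
  have hmain : TendstoUniformlyOn (fun i y => G (u i y, v i y, l i))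
      (fun y => G (u₀ y, v₀ y, l₀)) F (Icc 0 R) := by
    have hc : Continuous fun y => G (u₀ y, v₀ y, l₀) :=
      hG.comp (h₀.continuous.1.prodMk (h₀.continuous.2.prodMk continuous_const))
    rw [tendstoUniformlyOn_iff_forall_tendsto_prod isCompact_Icc hc.continuousOn]
    intro x hx
    have := hU x hx
    exact (hG.tendsto (u₀ x, v₀ x, l₀)).comp (((continuous_fst.tendsto _).comp this).prodMk_nhds
      (((continuous_snd.tendsto _).comp this).prodMk_nhds (hl.comp tendsto_fst)))
  rw [e₀]
  refine hmain.congr ?_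
  filter_upwards [h] with i hi y _
  exact (hjet _ _ _ hi y).symm

theorem isPendulum_exp_neg : IsPendulum 0 (fun x => Real.exp (-x)) (fun x => -Real.exp (-x)) := by
  intro y
  have h : HasDerivAt (fun x : ℝ => Real.exp (-x)) (-Real.exp (-y)) y := by
    simpa using (hasDerivAt_neg y).exp
  refine ⟨h, ?_⟩
  exact h.neg.congr_deriv (by rw [pendulumForce_zero, neg_neg])

theorem hasDerivAt_two_mul_arctan_exp (t y : ℝ) :
    HasDerivAt (fun x => 2 * Real.arctan (t * Real.exp (-x)))
      (-Real.sin (2 * Real.arctan (t * Real.exp (-y)))) y := by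
  have h : HasDerivAt (fun x : ℝ => Real.exp (-x)) (-Real.exp (-y)) y := by
    simpa using (hasDerivAt_neg y).exp
  refine ((h.const_mul t).arctan.const_mul 2).congr_deriv ?_
  rw [Real.sin_two_mul, Real.sin_arctan, Real.cos_arctan]
  have h1 : 0 < 1 + (t * Real.exp (-y)) ^ 2 := by positivity
  have h2 := Real.sq_sqrt h1.le
  have h3 : 0 < √(1 + (t * Real.exp (-y)) ^ 2) := Real.sqrt_pos.2 h1
  generalize √(1 + (t * Real.exp (-y)) ^ 2) = s at *
  rw [← h2]
  field_simp

/-- The limit is the separatrix, with first integral zero: `u' = -sin u`, hence `u'' = sin u cos u`.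
-/
theorem isPendulum_two_mul_arctan_exp (t : ℝ) :
    IsPendulum 1 (fun x => 2 * Real.arctan (t * Real.exp (-x)))
      (fun x => -Real.sin (2 * Real.arctan (t * Real.exp (-x)))) := by
  intro y
  refine ⟨hasDerivAt_two_mul_arctan_exp t y,
    (hasDerivAt_two_mul_arctan_exp t y).sin.neg.congr_deriv ?_⟩
  rw [pendulumForce_of_ne_zero one_ne_zero, mul_one, Real.sin_two_mul (2 * _)]
  ring

namespace IsProfile

variable {β κ c : ℝ} {φ : ℝ → ℝ}

/-- The rescaled profile is a pendulum. -/
theorem isPendulum (p : IsProfile β κ c φ) (hβ : 0 < β) {l : ℝ} (hl : l ≠ 0) :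
    IsPendulum l (fun y => φ (1 - β * y) / l) (fun y => -β * speed β c (φ (1 - β * y)) / l) := by
  intro y
  have h1 : HasDerivAt (fun y : ℝ => 1 - β * y) (-β) y := by
    simpa using ((hasDerivAt_id y).const_mul β).const_sub 1
  have h2 : HasDerivAt (fun y => φ (1 - β * y)) (speed β c (φ (1 - β * y)) * -β) y :=
    (p.hasDerivAt (1 - β * y)).comp y h1
  have h3 := (hasDerivAt_speed (β := β) p.c_pos (φ (1 - β * y))).comp y h2
  refine ⟨(h2.div_const l).congr_deriv (by ring),
    ((h3.const_mul (-β)).div_const l).congr_deriv ?_⟩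
  have e : 2 * l * (φ (1 - β * y) / l) = 2 * φ (1 - β * y) := by field_simp
  rw [pendulumForce_of_ne_zero hl, e, Real.sin_two_mul]
  have := (speed_pos (β := β) p.c_pos (φ (1 - β * y))).ne'
  field_simp

end IsProfile

/-! ### From minimizers to globally smooth profiles -/

/-- Minimizers are determined only on `[0,1]`; replacing them by profiles smooth on the line turns
one-sided derivatives into ordinary ones. -/
theorem tendstoSmooth_of_eqOn {D : ℝ → Set ℝ} {w u : ℝ → ℝ → ℝ} {D₀ : Set ℝ}
    {u₀ : ℝ → ℝ} {K : Set ℝ}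
    (hD : ∀ᶠ β in 𝓝[>] (0 : ℝ), UniqueDiffOn ℝ (D β) ∧ K ⊆ D β ∧ ContDiff ℝ ∞ (u β) ∧
      EqOn (w β) (u β) (D β))
    (hD₀ : UniqueDiffOn ℝ D₀) (hK₀ : K ⊆ D₀) (hu₀ : ContDiff ℝ ∞ u₀)
    (h : ∀ k, TendstoUniformlyOn (fun β => iteratedDeriv k (u β)) (iteratedDeriv k u₀)
      (𝓝[>] (0 : ℝ)) K) :
    TendstoSmooth D w D₀ u₀ K := by
  refine ⟨?_, fun k => ?_⟩
  · filter_upwards [hD] with β ⟨_, h2, h3, h4⟩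
    exact ⟨h2, h3.contDiffOn.congr h4⟩
  · refine ((h k).congr ?_).congr_right fun x hx => ?_
    · filter_upwards [hD] with β ⟨h1, h2, h3, h4⟩ x hx
      rw [iteratedDerivWithin_congr h4 (h2 hx), iteratedDerivWithin_eq_iteratedDeriv h1
        (h3.contDiffAt.of_le (by exact_mod_cast le_top)) (h2 hx)]
    · rw [iteratedDerivWithin_eq_iteratedDeriv hD₀
        (hu₀.contDiffAt.of_le (by exact_mod_cast le_top)) (hK₀ hx)]

/-- A family of profiles, with the family of minimizers they represent. -/
structure IsProfileFamily (κ c : ℝ → ℝ) (φ p : ℝ → ℝ → ℝ) (β : ℝ) : Prop where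
  pos : 0 < β
  κ_pos : 0 < κ β
  κ_lt : κ β < 1 / (Real.pi * β)
  isProfile : IsProfile β (κ β) (c β) (p β)
  eqOn : EqOn (φ β) (p β) (Icc 0 1)
  energyF_eq : energyF β (κ β) (φ β) = energyF β (κ β) (p β)

theorem exists_isProfileFamily {κ : ℝ → ℝ} {φ : ℝ → ℝ → ℝ}
    (h : ∀ᶠ β in 𝓝[>] (0 : ℝ),
      0 < κ β ∧ κ β < 1 / (Real.pi * β) ∧ IsMinimizer β (κ β) (φ β)) :
    ∃ (c : ℝ → ℝ) (p : ℝ → ℝ → ℝ), ∀ᶠ β in 𝓝[>] (0 : ℝ), IsProfileFamily κ c φ p β := by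
  have hex : ∀ β : ℝ, ∃ (c : ℝ) (p : ℝ → ℝ), 0 < β → 0 < κ β → κ β < 1 / (Real.pi * β) →
      IsProfile β (κ β) c p := by
    intro β
    by_cases hβ : 0 < β ∧ 0 < κ β ∧ κ β < 1 / (Real.pi * β)
    · obtain ⟨c, p, hp⟩ := exists_isProfile hβ.1 hβ.2.1 (two_mul_mul_lt_one hβ.1 hβ.2.2).2
      exact ⟨c, p, fun _ _ _ => hp⟩
    · exact ⟨0, 0, fun h1 h2 h3 => absurd ⟨h1, h2, h3⟩ hβ⟩
  choose c p hcp using hex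
  refine ⟨c, p, ?_⟩
  filter_upwards [h, self_mem_nhdsWithin] with β ⟨h1, h2, h3⟩ hβ
  have hp := hcp β hβ h1 h2
  have hm := hp.isMinimizer hβ h1 h2
  -- The energies agree because both functions are minimizers, which avoids comparing the weak
  -- derivatives chosen for each.
  exact ⟨hβ, h1, h2, hp, hp.eqOn_of_isMinimizer hβ h1 h2 h3,
    le_antisymm (h3.2 _ hm.1) (hm.2 _ h3.1)⟩

theorem exists_delta_of_isCompact {K : Set ℝ} (hK : IsCompact K) (hs : K ⊆ Ico 0 1) :
    ∃ δ : ℝ, 0 < δ ∧ δ ≤ 1 / 2 ∧ K ⊆ Icc 0 (1 - δ) := by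
  rcases K.eq_empty_or_nonempty with rfl | hne
  · exact ⟨1 / 2, by norm_num, le_rfl, by simp⟩
  · obtain ⟨y, hy, hy'⟩ := hK.exists_isGreatest hne
    have h1 := (hs hy).2
    refine ⟨min (1 / 2) (1 - y), lt_min (by norm_num) (by linarith), min_le_left _ _, fun x hx =>
      ⟨(hs hx).1, ?_⟩⟩
    have := hy' hx
    have := min_le_right (1 / 2) (1 - y)
    linarith

theorem exists_Icc_zero_of_isCompact {K : Set ℝ} (hK : IsCompact K) (hs : K ⊆ Ici 0) :
    ∃ R : ℝ, 0 < R ∧ K ⊆ Icc 0 R := by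
  obtain ⟨R, hR⟩ := hK.bddAbove
  exact ⟨max R 1, by positivity, fun x hx => ⟨hs hx, (hR hx).trans (le_max_left _ _)⟩⟩

/-! ### Decay of all derivatives away from the end point -/

namespace IsProfile

variable {β κ c : ℝ} {φ : ℝ → ℝ}

/-- Undoes the rescaling: `φ x = l u((1 - x)/β)`, so each derivative costs a factor `-1/β`. -/
theorem iteratedDeriv_eq (p : IsProfile β κ c φ) (hβ : 0 < β) {l : ℝ} (hl : l ≠ 0) (k : ℕ) (x : ℝ) :
    iteratedDeriv k φ x =
      l * ((β⁻¹) ^ k * ((-1) ^ k *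
        iteratedDeriv k (fun y => φ (1 - β * y) / l) (β⁻¹ - β⁻¹ * x))) := by
  set u : ℝ → ℝ := fun y => φ (1 - β * y) / l with hu
  have hus : ContDiff ℝ ∞ u := (p.contDiff.comp (by fun_prop)).div_const l
  have e : φ = fun x => l * (fun x => (fun z => u (β⁻¹ - z)) (β⁻¹ * x)) x := by
    funext x
    simp only [hu]
    have : 1 - β * (β⁻¹ - β⁻¹ * x) = x := by field_simp; ring
    rw [this]
    field_simp
  have hw : ContDiff ℝ k fun z => u (β⁻¹ - z) :=
    (hus.of_le (by exact_mod_cast le_top)).comp (contDiff_const.sub contDiff_id)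
  conv_lhs => rw [e]
  rw [iteratedDeriv_const_mul_field, iteratedDeriv_comp_const_mul hw, iteratedDeriv_comp_const_sub]
  simp only [smul_eq_mul]

/-- Exponential decay of all derivatives away from `1`. -/
theorem exists_iteratedDeriv_bound {δ : ℝ} (hδ : 0 < δ) (hδ' : δ ≤ 1 / 2) (k : ℕ) :
    ∃ C : ℝ, ∀ (β κ c : ℝ) (φ : ℝ → ℝ), IsProfile β κ c φ → 0 < β → β ≤ 1 → 0 < κ →
      2 * κ * β < 1 → ∀ x ∈ Icc (0 : ℝ) (1 - δ),
        |iteratedDeriv k φ x| ≤ C * (Real.exp (-(δ / β)) / β ^ k) := by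
  obtain ⟨G, hG, hjet⟩ := exists_jet k
  obtain ⟨C, hC⟩ := (isCompact_Icc (a := ((-10, -10, -10) : ℝ × ℝ × ℝ)) (b := (10, 10, 10))
    ).exists_bound_of_continuousOn hG.continuousOn
  refine ⟨C, fun β κ c φ p hβ hβ1 hκ hk x hx => ?_⟩
  set l := Real.exp (-(δ / β)) with hl
  have hl0 : 0 < l := Real.exp_pos _
  have hl1 : l ≤ 1 := Real.exp_le_one_iff.2 (by simp; positivity)
  have hkβ : 0 < κ * β := by positivity
  have hx1 : x ∈ Icc (0 : ℝ) 1 := ⟨hx.1, by linarith [hx.2]⟩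
  have h1 : φ x ≤ 2 * l := by
    have h := p.map_le hβ hκ hx1
    have h2 : Real.exp ((x - 1) / β) ≤ l := by
      rw [hl, ← neg_div]
      gcongr
      linarith [hx.2]
    have h3 := Real.exp_pos ((x - 1) / β)
    nlinarith
  have h0 : 0 ≤ φ x := p.map_nonneg hx.1
  have h2 : β * speed β c (φ x) ≤ 6 * l := by
    have h3 := speed_le_add hβ p.c_pos.le (φ x)
    have h4 : |Real.sin (φ x)| ≤ φ x := Real.abs_sin_le_abs.trans_eq (abs_of_nonneg h0)
    have h5 := p.sqrt_le hβ hκ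
    have h6 : Real.exp (-(1 / 2 / β)) ≤ l := by
      rw [hl]
      gcongr
    have h7 : √c ≤ 4 * l := by
      have := Real.exp_pos (-(1 / 2 / β))
      nlinarith
    have h8 : β * √c ≤ 1 * (4 * l) := mul_le_mul hβ1 h7 (Real.sqrt_nonneg _) zero_le_one
    calc β * speed β c (φ x) ≤ β * (√c + |Real.sin (φ x)| / β) := by gcongr
      _ = β * √c + |Real.sin (φ x)| := by field_simp
      _ ≤ 6 * l := by linarith
  have h3 : 0 ≤ β * speed β c (φ x) := mul_nonneg hβ.le (speed_nonneg _)
  have ex : 1 - β * (β⁻¹ - β⁻¹ * x) = x := by field_simp; ring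
  rw [p.iteratedDeriv_eq hβ hl0.ne' k x, hjet _ _ _ (p.isPendulum hβ hl0.ne'), ex]
  have hb := hC (φ x / l, -β * speed β c (φ x) / l, l) (by
    have a1 : 0 ≤ φ x / l := by positivity
    have a2 : φ x / l ≤ 2 := by rwa [div_le_iff₀ hl0]
    have a3 : -β * speed β c (φ x) / l ≤ 0 := div_nonpos_of_nonpos_of_nonneg (by linarith) hl0.le
    have a4 : -6 ≤ -β * speed β c (φ x) / l := by rw [le_div_iff₀ hl0]; linarith
    simp only [mem_Icc, Prod.mk_le_mk]
    refine ⟨⟨?_, ?_, ?_⟩, ?_, ?_, ?_⟩ <;> linarith)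
  rw [Real.norm_eq_abs] at hb
  rw [abs_mul, abs_mul, abs_mul, abs_pow, abs_pow, abs_neg, abs_one, one_pow, one_mul,
    abs_of_pos hl0, abs_of_pos (inv_pos.2 hβ)]
  calc l * (β⁻¹ ^ k * |G (φ x / l, -β * speed β c (φ x) / l, l)|) ≤ l * (β⁻¹ ^ k * C) := by gcongr
    _ = C * (l / β ^ k) := by rw [inv_pow]; field_simp

end IsProfile

/-! ### Asymptotics of the minimizers -/

section family

variable {κ c : ℝ → ℝ} {φ p : ℝ → ℝ → ℝ}

theorem tendstoSmooth_zero (h : ∀ᶠ β in 𝓝[>] (0 : ℝ), IsProfileFamily κ c φ p β)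
    {K : Set ℝ} (hK : IsCompact K) (hs : K ⊆ Ico 0 1) :
    TendstoSmooth (fun _ => Icc 0 1) φ (Icc 0 1) (fun _ => 0) K := by
  have hs' : K ⊆ Icc 0 1 := hs.trans Ico_subset_Icc_self
  refine tendstoSmooth_of_eqOn (u := p) ?_ (uniqueDiffOn_Icc zero_lt_one) hs' contDiff_const
    fun k => ?_
  · filter_upwards [h] with β hβ
    exact ⟨uniqueDiffOn_Icc zero_lt_one, hs', hβ.isProfile.contDiff, hβ.eqOn⟩
  · obtain ⟨δ, h1, h2, h3⟩ := exists_delta_of_isCompact hK hs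
    obtain ⟨C, hC⟩ := IsProfile.exists_iteratedDeriv_bound h1 h2 k
    have hlim : Tendsto (fun β : ℝ => C * (Real.exp (-(δ / β)) / β ^ k)) (𝓝[>] 0) (𝓝 0) := by
      simpa using (tendsto_exp_neg_div_div_pow h1 k).const_mul C
    have hz : iteratedDeriv k (fun _ : ℝ => (0 : ℝ)) = fun _ => 0 := by
      funext x; simp
    rw [hz, Metric.tendstoUniformlyOn_iff]
    intro ε hε
    have hle : ∀ᶠ β : ℝ in 𝓝[>] 0, β < 1 := mem_nhdsWithin_of_mem_nhds (Iio_mem_nhds one_pos)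
    filter_upwards [h, hlim.eventually (gt_mem_nhds hε), hle] with β hβ h4 h5 x hx
    rw [dist_comm, Real.dist_eq, sub_zero]
    exact (hC _ _ _ _ hβ.isProfile hβ.pos h5.le hβ.κ_pos
      (two_mul_mul_lt_one hβ.pos hβ.κ_lt).2 x (h3 hx)).trans_lt h4

theorem eventually_subset_Icc_one_div {K : Set ℝ} {R : ℝ} (hR : 0 < R) (hK : K ⊆ Icc 0 R) :
    ∀ᶠ β : ℝ in 𝓝[>] 0, 0 < β ∧ K ⊆ Icc 0 (1 / β) := by
  have : ∀ᶠ β : ℝ in 𝓝[>] 0, β < 1 / R :=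
    mem_nhdsWithin_of_mem_nhds (Iio_mem_nhds (by positivity))
  filter_upwards [this, self_mem_nhdsWithin] with β h1 (h2 : 0 < β)
  refine ⟨h2, hK.trans (Icc_subset_Icc_right ?_)⟩
  rw [lt_div_iff₀ hR] at h1
  rw [le_div_iff₀ h2]
  linarith

/-- Blow-up at the end point `1`. -/
theorem tendstoSmooth_blowup (h : ∀ᶠ β in 𝓝[>] (0 : ℝ), IsProfileFamily κ c φ p β)
    {l : ℝ → ℝ} {l₀ : ℝ} {u₀ v₀ : ℝ → ℝ} (hl : ∀ᶠ β in 𝓝[>] (0 : ℝ), l β ≠ 0)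
    (hl₀ : Tendsto l (𝓝[>] 0) (𝓝 l₀)) (h₀ : IsPendulum l₀ u₀ v₀) (hu₀ : ContDiff ℝ ∞ u₀)
    (hu : Tendsto (fun β => p β 1 / l β) (𝓝[>] 0) (𝓝 (u₀ 0)))
    (hv : Tendsto (fun β => -(2 * κ β * β) / l β) (𝓝[>] 0) (𝓝 (v₀ 0)))
    {K : Set ℝ} (hK : IsCompact K) (hs : K ⊆ Ici 0) :
    TendstoSmooth (fun β => Icc 0 (1 / β)) (fun β x => φ β (1 - β * x) / l β) (Ici 0) u₀ K := by
  obtain ⟨R, hR, hKR⟩ := exists_Icc_zero_of_isCompact hK hs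
  refine tendstoSmooth_of_eqOn (u := fun β x => p β (1 - β * x) / l β) ?_ (uniqueDiffOn_Ici 0) hs
    hu₀ fun k => ?_
  · filter_upwards [h, eventually_subset_Icc_one_div hR hKR] with β hβ ⟨h1, h2⟩
    refine ⟨uniqueDiffOn_Icc (by positivity), h2,
      (hβ.isProfile.contDiff.comp (by fun_prop)).div_const _, fun x hx => ?_⟩
    have h3 := hx.2
    rw [le_div_iff₀ h1] at h3
    have h4 : 0 ≤ x * β := mul_nonneg hx.1 h1.le
    simp only
    rw [hβ.eqOn ⟨by linarith, by linarith⟩]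
  · refine (tendstoUniformlyOn_iteratedDeriv
      (v := fun β y => -β * speed β (c β) (p β (1 - β * y)) / l β) ?_ h₀ hl₀ ?_ ?_ k).mono hKR
    · filter_upwards [h, hl] with β hβ hlβ
      exact hβ.isProfile.isPendulum hβ.pos hlβ
    · simpa using hu
    -- The initial velocity is exact, by the natural boundary condition `φ'(1) = 2κ`.
    · refine hv.congr' ?_
      filter_upwards [h] with β hβ
      rw [mul_zero, sub_zero, hβ.isProfile.speed_map_one hβ.κ_pos]
      ring

/-- The first integral gives `sin² = (2κβ)² - β² c` at the end point, and `c ≤ 64 (κβ)²` makes the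
correction at most `16 β²` relative to `(2κβ)²`. -/
theorem tendsto_sin_div (h : ∀ᶠ β in 𝓝[>] (0 : ℝ), IsProfileFamily κ c φ p β) :
    Tendsto (fun β => Real.sin (p β 1) / (2 * κ β * β)) (𝓝[>] 0) (𝓝 1) := by
  have hlow : Tendsto (fun β : ℝ => 1 - 16 * β ^ 2) (𝓝[>] 0) (𝓝 1) := by
    have : Continuous fun β : ℝ => 1 - 16 * β ^ 2 := by fun_prop
    simpa using (this.tendsto 0).mono_left nhdsWithin_le_nhds
  refine tendsto_of_tendsto_of_tendsto_of_le_of_le' hlow tendsto_const_nhds ?_ ?_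
  · filter_upwards [h] with β hβ
    have hp := hβ.isProfile
    have hβ0 := hβ.pos
    have hκ0 := hβ.κ_pos
    have hk : 0 < 2 * κ β * β := by positivity
    have h1 := hp.sin_map_one_sq hβ.pos
    have h2 := hp.c_le hβ.pos hβ.κ_pos
    have h3 : Real.exp (-(1 / 2 / β)) ≤ 1 := Real.exp_le_one_iff.2 (by simp; positivity)
    have h4 : c β ≤ 64 * (κ β * β) ^ 2 := by nlinarith [sq_nonneg (κ β * β)]
    have h5 := hp.sin_map_one_pos
    have h6 := hp.sin_map_one_le hβ.pos hβ.κ_pos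
    have h7 : Real.sin (p β 1) ^ 2 ≤ Real.sin (p β 1) * (2 * κ β * β) := by
      rw [sq]; gcongr
    rw [le_div_iff₀ hk]
    have h8 : β ^ 2 * c β ≤ β ^ 2 * (64 * (κ β * β) ^ 2) := by gcongr
    refine le_of_mul_le_mul_right ?_ hk
    nlinarith
  · filter_upwards [h] with β hβ
    have hβ0 := hβ.pos
    have hκ0 := hβ.κ_pos
    rw [div_le_one (by positivity)]
    exact hβ.isProfile.sin_map_one_le hβ.pos hβ.κ_pos

/-- If `κβ` converges, so does the end point value. -/
theorem tendsto_map_one (h : ∀ᶠ β in 𝓝[>] (0 : ℝ), IsProfileFamily κ c φ p β) {k : ℝ}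
    (hk : Tendsto (fun β => κ β * β) (𝓝[>] 0) (𝓝 k)) :
    Tendsto (fun β => p β 1) (𝓝[>] 0) (𝓝 (Real.arcsin (2 * k))) := by
  have h1 : Tendsto (fun β => Real.sin (p β 1)) (𝓝[>] 0) (𝓝 (2 * k)) := by
    have := (tendsto_sin_div h).mul (hk.const_mul 2)
    rw [one_mul] at this
    refine this.congr' ?_
    filter_upwards [h] with β hβ
    have hβ0 := hβ.pos
    have hκ0 := hβ.κ_pos
    field_simp
  refine ((Real.continuous_arcsin.tendsto _).comp h1).congr' ?_
  filter_upwards [h] with β hβ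
  have := hβ.isProfile.map_one_pos
  exact Real.arcsin_sin (by linarith [Real.pi_pos]) hβ.isProfile.map_one_lt.le

theorem eventuallyEq_map_one (h : ∀ᶠ β in 𝓝[>] (0 : ℝ), IsProfileFamily κ c φ p β) :
    (fun β => φ β 1) =ᶠ[𝓝[>] 0] fun β => p β 1 := by
  filter_upwards [h] with β hβ
  exact hβ.eqOn (by simp)

theorem tendsto_div_sin_of_tendsto_zero {F : Filter ℝ} {a : ℝ → ℝ} (ha : Tendsto a F (𝓝 0))
    (h0 : ∀ᶠ β in F, a β ≠ 0) : Tendsto (fun β => a β / Real.sin (a β)) F (𝓝 1) := by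
  have h := ((Real.continuous_sinc.tendsto 0).comp ha).inv₀ (by simp)
  rw [Real.sinc_zero, inv_one] at h
  refine h.congr' ?_
  filter_upwards [h0] with β hβ
  rw [Function.comp, Real.sinc_of_ne_zero hβ, inv_div]

theorem tendsto_map_one_div (h : ∀ᶠ β in 𝓝[>] (0 : ℝ), IsProfileFamily κ c φ p β)
    (hk : Tendsto (fun β => κ β * β) (𝓝[>] 0) (𝓝 0)) :
    Tendsto (fun β => p β 1 / (2 * κ β * β)) (𝓝[>] 0) (𝓝 1) := by
  have h1 := tendsto_map_one h hk
  rw [mul_zero, Real.arcsin_zero] at h1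
  have h2 := (tendsto_div_sin_of_tendsto_zero h1 (by
    filter_upwards [h] with β hβ using hβ.isProfile.map_one_pos.ne')).mul (tendsto_sin_div h)
  rw [one_mul] at h2
  refine h2.congr' ?_
  filter_upwards [h] with β hβ
  have := hβ.isProfile.sin_map_one_pos
  field_simp

theorem energyF_sub_isLittleO (h : ∀ᶠ β in 𝓝[>] (0 : ℝ), IsProfileFamily κ c φ p β) {k : ℝ}
    (hk : ∀ᶠ β in 𝓝[>] (0 : ℝ), κ β * β = k) (n : ℕ) :
    (fun β => energyF β (κ β) (φ β)
      - ((1 - √(1 - 4 * k ^ 2)) / (4 * β) - k / (2 * β) * Real.arcsin (2 * k)))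
      =o[𝓝[>] (0 : ℝ)] (fun β => β ^ n) := by
  have hO : (fun β => energyF β (κ β) (φ β)
      - ((1 - √(1 - 4 * k ^ 2)) / (4 * β) - k / (2 * β) * Real.arcsin (2 * k)))
      =O[𝓝[>] (0 : ℝ)] (fun β => Real.exp (-(1 / 2 / β))) := by
    refine IsBigO.of_bound (16 * k ^ 2) ?_
    filter_upwards [h, hk] with β hβ hkβ
    have := hβ.isProfile.abs_energyF_sub_le hβ.pos hβ.κ_pos hβ.κ_lt
    rw [hkβ] at this
    rw [hβ.energyF_eq, Real.norm_eq_abs, Real.norm_of_nonneg (Real.exp_pos _).le]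
    exact this
  refine hO.trans_isLittleO ((isLittleO_iff_tendsto' ?_).2
    (tendsto_exp_neg_div_div_pow (by norm_num) n))
  filter_upwards [self_mem_nhdsWithin] with β (hβ : 0 < β) h0
  exact absurd h0 (by positivity)

/-- Divided by `κ² β`, the two main terms tend to `1/2` and `1`, and the error is at most `16 β`;
the quotient by `-κ² β / 2` therefore tends to `-2 (1/2 - 1) = 1`. -/
theorem energyF_isEquivalent (h : ∀ᶠ β in 𝓝[>] (0 : ℝ), IsProfileFamily κ c φ p β)
    (hk : Tendsto (fun β => κ β * β) (𝓝[>] 0) (𝓝 0)) :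
    (fun β => energyF β (κ β) (φ β)) ~[𝓝[>] (0 : ℝ)] (fun β => -(κ β ^ 2 * β) / 2) := by
  have hpos : ∀ᶠ β in 𝓝[>] (0 : ℝ), 0 < β ∧ 0 < κ β := by
    filter_upwards [h] with β hβ using ⟨hβ.pos, hβ.κ_pos⟩
  rw [isEquivalent_iff_tendsto_one (by
    filter_upwards [hpos] with β ⟨h1, h2⟩
    have : 0 < κ β ^ 2 * β := by positivity
    linarith)]
  have hA : Tendsto (fun β => Real.arcsin (2 * (κ β * β)) / (2 * (κ β * β))) (𝓝[>] 0) (𝓝 1) := by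
    have h1 : Tendsto (fun β => Real.arcsin (2 * (κ β * β))) (𝓝[>] 0) (𝓝 0) := by
      have := (Real.continuous_arcsin.tendsto _).comp (hk.const_mul 2)
      simpa [Function.comp_def] using this
    refine (tendsto_div_sin_of_tendsto_zero h1 ?_).congr' ?_
    · filter_upwards [hpos] with β ⟨h1, h2⟩
      exact (Real.arcsin_pos.2 (by positivity)).ne'
    · filter_upwards [h] with β hβ
      have h1 := (two_mul_mul_lt_one hβ.pos hβ.κ_lt).2
      have h2 : 0 < κ β * β := mul_pos hβ.κ_pos hβ.pos
      rw [Real.sin_arcsin (by linarith) (by linarith)]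
  have hB : Tendsto (fun β => (1 + √(1 - 4 * (κ β * β) ^ 2))⁻¹) (𝓝[>] 0) (𝓝 (1 / 2)) := by
    have hc : ContinuousAt (fun k : ℝ => (1 + √(1 - 4 * k ^ 2))⁻¹) 0 := by
      refine ContinuousAt.inv₀ (by fun_prop) ?_
      positivity
    have e : (1 + √(1 - 4 * (0 : ℝ) ^ 2))⁻¹ = 1 / 2 := by
      rw [show (1 : ℝ) - 4 * 0 ^ 2 = 1 by norm_num, Real.sqrt_one]
      norm_num
    rw [← e]
    exact hc.tendsto.comp hk
  have hE : Tendsto (fun β => (energyF β (κ β) (φ β) - ((1 - √(1 - 4 * (κ β * β) ^ 2)) / (4 * β)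
      - κ β * β / (2 * β) * Real.arcsin (2 * (κ β * β)))) / (κ β ^ 2 * β)) (𝓝[>] 0) (𝓝 0) := by
    refine squeeze_zero_norm' (a := fun β : ℝ => 16 * β) ?_ ?_
    · filter_upwards [h] with β hβ
      have hβ0 := hβ.pos
      have hκ0 := hβ.κ_pos
      have h1 := hβ.isProfile.abs_energyF_sub_le hβ.pos hβ.κ_pos hβ.κ_lt
      have h3 : Real.exp (-(1 / 2 / β)) ≤ 1 := Real.exp_le_one_iff.2 (by simp; positivity)
      rw [hβ.energyF_eq, Real.norm_eq_abs, abs_div, abs_of_pos (show 0 < κ β ^ 2 * β by positivity),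
        div_le_iff₀ (by positivity)]
      refine h1.trans ?_
      calc 16 * (κ β * β) ^ 2 * Real.exp (-(1 / 2 / β)) ≤ 16 * (κ β * β) ^ 2 * 1 := by gcongr
        _ = _ := by ring
    · have : Continuous fun β : ℝ => 16 * β := by fun_prop
      simpa using (this.tendsto 0).mono_left nhdsWithin_le_nhds
  have hsum := ((hB.sub hA).add hE).const_mul (-2)
  norm_num at hsum
  refine hsum.congr' ?_
  filter_upwards [h] with β hβ
  have hβ0 := hβ.pos
  have hκ0 := hβ.κ_pos
  have h1 := (two_mul_mul_lt_one hβ.pos hβ.κ_lt).2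
  have h2 : 0 < κ β * β := mul_pos hβ.κ_pos hβ.pos
  have hs := Real.sq_sqrt (show 0 ≤ 1 - 4 * (κ β * β) ^ 2 by nlinarith)
  have hs0 := Real.sqrt_nonneg (1 - 4 * (κ β * β) ^ 2)
  have e : (1 + √(1 - 4 * (κ β * β) ^ 2))⁻¹
      = (1 - √(1 - 4 * (κ β * β) ^ 2)) / (4 * (κ β * β) ^ 2) := by
    rw [inv_eq_one_div, div_eq_div_iff (by positivity) (by positivity)]
    linarith
  rw [e]
  generalize √(1 - 4 * (κ β * β) ^ 2) = s
  generalize Real.arcsin (2 * (κ β * β)) = a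
  simp only [Pi.div_apply]
  field_simp
  ring

end family

theorem theorem1 :
    -- existence, uniqueness, bounds and exponential estimate
    (∀ β κ : ℝ, 0 < β → 0 < κ → κ < 1 / (Real.pi * β) →
      ∃ φ : ℝ → ℝ, IsMinimizer β κ φ ∧
        (∀ χ : ℝ → ℝ, IsMinimizer β κ χ → EqOn χ φ (Icc 0 1)) ∧
        ContDiffOn ℝ ∞ φ (Icc 0 1) ∧
        (∀ x ∈ Ioo (0 : ℝ) 1, 0 < φ x ∧ φ x < Real.pi / 2) ∧
        (∀ x ∈ Ico (0 : ℝ) 1,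
          φ x < 2 * Real.arctan (Real.tan (φ 1 / 2) * Real.exp ((x - 1) / β)))) ∧
    -- asymptotics as `β → 0⁺`, where `κ` may depend on `β`
    (∀ (κ : ℝ → ℝ) (φ : ℝ → ℝ → ℝ),
      (∀ᶠ β in 𝓝[>] (0 : ℝ),
        0 < κ β ∧ κ β < 1 / (Real.pi * β) ∧ IsMinimizer β (κ β) (φ β)) →
      (∀ K : Set ℝ, IsCompact K → K ⊆ Ico 0 1 →
        TendstoSmooth (fun _ => Icc 0 1) φ (Icc 0 1) (fun _ => 0) K) ∧
      -- the case where `κ β = κ'` does not depend on `β`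
      (∀ κ' : ℝ, (∀ᶠ β in 𝓝[>] (0 : ℝ), κ β * β = κ') →
        Tendsto (fun β => φ β 1) (𝓝[>] 0) (𝓝 (Real.arcsin (2 * κ'))) ∧
        (∀ n : ℕ, 1 ≤ n →
          (fun β => energyF β (κ β) (φ β)
              - ((1 - √(1 - 4 * κ' ^ 2)) / (4 * β) - κ' / (2 * β) * Real.arcsin (2 * κ')))
            =o[𝓝[>] (0 : ℝ)] (fun β => β ^ n)) ∧
        (∀ K : Set ℝ, IsCompact K → K ⊆ Ici 0 →
          TendstoSmooth (fun β => Icc 0 (1 / β)) (fun β x => φ β (1 - β * x)) (Ici 0)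
            (fun x => 2 * Real.arctan (Real.tan (Real.arcsin (2 * κ') / 2) * Real.exp (-x)))
            K)) ∧
      -- the case where `κ β → 0`
      (Tendsto (fun β => κ β * β) (𝓝[>] 0) (𝓝 0) →
        (fun β => φ β 1) ~[𝓝[>] (0 : ℝ)] (fun β => 2 * κ β * β) ∧
        (fun β => energyF β (κ β) (φ β)) ~[𝓝[>] (0 : ℝ)] (fun β => -(κ β ^ 2 * β) / 2) ∧
        (∀ K : Set ℝ, IsCompact K → K ⊆ Ici 0 →
          TendstoSmooth (fun β => Icc 0 (1 / β))
            (fun β x => φ β (1 - β * x) / (2 * κ β * β)) (Ici 0)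
            (fun x => Real.exp (-x)) K))) := by
  refine ⟨fun β κ hβ hκ h => ?_, fun κ φ hφ => ?_⟩
  · obtain ⟨c, φ, p⟩ := exists_isProfile hβ hκ (two_mul_mul_lt_one hβ h).2
    refine ⟨φ, p.isMinimizer hβ hκ h, fun χ hχ => p.eqOn_of_isMinimizer hβ hκ h hχ,
      p.contDiff.contDiffOn, fun x hx => ⟨?_, ?_⟩, fun x hx => p.lt_barrier hβ hx⟩
    · simpa only [p.map_zero] using p.strictMono hx.1
    · exact (p.strictMono hx.2).trans p.map_one_lt
  · obtain ⟨c, p, hp⟩ := exists_isProfileFamily hφ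
    refine ⟨fun K hK hs => tendstoSmooth_zero hp hK hs, fun k hk => ?_, fun hk => ?_⟩
    · have hk' : Tendsto (fun β => κ β * β) (𝓝[>] 0) (𝓝 k) :=
        tendsto_const_nhds.congr' (by filter_upwards [hk] with β hβ using hβ.symm)
      have h1 := tendsto_map_one hp hk'
      -- The constant `k` inherits `0 < k` and `2k < 1` from a single admissible `β`.
      obtain ⟨β, hβ, hβk⟩ := (hp.and hk).exists
      have hk0 : 0 < k := hβk ▸ mul_pos hβ.κ_pos hβ.pos
      have hk1 : 2 * k < 1 := by
        rw [← hβk, ← mul_assoc]; exact (two_mul_mul_lt_one hβ.pos hβ.κ_lt).2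
      refine ⟨h1.congr' (eventuallyEq_map_one hp).symm, fun n _ => energyF_sub_isLittleO hp hk n,
        fun K hK hs => ?_⟩
      have ha : 2 * Real.arctan (Real.tan (Real.arcsin (2 * k) / 2) * Real.exp (-0))
          = Real.arcsin (2 * k) := by
        have h2 := Real.arcsin_lt_pi_div_two.2 hk1
        have h3 := Real.arcsin_nonneg.2 (show 0 ≤ 2 * k by positivity)
        rw [neg_zero, Real.exp_zero, mul_one,
          Real.arctan_tan (by linarith [Real.pi_pos]) (by linarith)]
        ring
      have := tendstoSmooth_blowup hp (l := fun _ => 1) (by simp) tendsto_const_nhds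
        (isPendulum_two_mul_arctan_exp (Real.tan (Real.arcsin (2 * k) / 2)))
        (contDiff_const.mul (Real.contDiff_arctan.comp (by fun_prop)))
        (by rw [ha]; simpa using h1)
        (by
          rw [ha, Real.sin_arcsin (by linarith) hk1.le]
          refine (hk'.const_mul 2).neg.congr fun β => ?_
          ring) hK hs
      simpa using this
    · have h1 := tendsto_map_one_div hp hk
      have hne : ∀ᶠ β in 𝓝[>] (0 : ℝ), 2 * κ β * β ≠ 0 := by
        filter_upwards [hp] with β hβ
        have := mul_pos hβ.κ_pos hβ.pos
        rw [mul_assoc]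
        positivity
      refine ⟨?_, energyF_isEquivalent hp hk, fun K hK hs => ?_⟩
      · rw [isEquivalent_iff_tendsto_one hne]
        refine h1.congr' ?_
        filter_upwards [eventuallyEq_map_one hp] with β hβ
        rw [Pi.div_apply, hβ]
      -- The scale `2κβ` is also the parameter `λ`; it tends to `0`, where the equation becomes `u''
      -- = u`, with initial data `1` and `-1`.
      · refine tendstoSmooth_blowup hp hne (l₀ := 0) ?_ isPendulum_exp_neg (by fun_prop)
          (by simpa using h1) ?_ hK hs
        · simpa [mul_assoc] using hk.const_mul 2
        · rw [neg_zero, Real.exp_zero]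
          refine tendsto_const_nhds.congr' ?_
          filter_upwards [hne] with β hβ
          rw [neg_div, div_self hβ]
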